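/- For every fixed integer $\ell\ge 0$ there is a polynomial-time algorithm that finds a maximum independent set of any given $(2,\ell)$-graph. Here a $(k,\ell)$-graph is a finite simple graph whose vertex set can be partitioned into $k$ independent sets and $\ell$ cliques, where parts may be empty. The algorithm (which may depend on $\ell$) receives only the number $n$ of vertices and the adjacency matrix of the graph; no $(2,\ell)$-partition is given. It outputs the indicator vector of an independent set of maximum cardinality, and its running time is bounded by a polynomial in $n$ (which may depend on $\ell$). Running time is counted in elementary steps on a random access machine whose arithmetic operations are addition and truncated subtraction of natural numbers. -/

import Mathlib

/-- A `(k, l)`-graph: the vertex set can be partitioned into `k` independent sets and `l` cliques,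
where parts are allowed to be empty. The fibres of `part` are the parts. -/
def IsKLGraph {V : Type*} (k l : ℕ) (G : SimpleGraph V) : Prop :=
  ∃ part : V → Fin k ⊕ Fin l,
    (∀ i : Fin k, G.IsIndepSet {v | part v = Sum.inl i}) ∧
    (∀ j : Fin l, G.IsClique {v | part v = Sum.inr j})

/-! Polynomial time is measured on a random access machine whose only arithmetic operations are
addition and truncated subtraction. There is no multiplication, so that after `t` steps the numbers
in memory have only `O(t)` more bits than the largest number of the input or the program, and
unit-cost running time agrees with Turing machine running time up to a polynomial. -/

namespace RAM

/-- The memory of the machine: scalar registers `reg x`, and arrays with cells `arr a i`, all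
holding natural numbers. A program mentions only finitely many registers and arrays; a cell index
may be computed at run time. -/
structure Memory where
  reg : ℕ → ℕ
  arr : ℕ → ℕ → ℕ

/-- The elementary instructions; `x`, `y`, `z` are names of registers and `a` is the name of an
array. -/
inductive Instr where
  /-- `x := c` -/
  | const (x c : ℕ)
  /-- `x := y` -/
  | move (x y : ℕ)
  /-- `x := y + z` -/
  | add (x y z : ℕ)
  /-- `x := max (y - z) 0` -/
  | sub (x y z : ℕ)
  /-- `x := a[y]` -/
  | load (x a y : ℕ)
  /-- `a[x] := y` -/
  | store (a x y : ℕ)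

/-- The effect of an elementary instruction on the memory. -/
def Instr.exec : Instr → Memory → Memory
  | .const x c, m => { m with reg := Function.update m.reg x c }
  | .move x y, m => { m with reg := Function.update m.reg x (m.reg y) }
  | .add x y z, m => { m with reg := Function.update m.reg x (m.reg y + m.reg z) }
  | .sub x y z, m => { m with reg := Function.update m.reg x (m.reg y - m.reg z) }
  | .load x a y, m => { m with reg := Function.update m.reg x (m.arr a (m.reg y)) }
  | .store a x y, m =>
      { m with arr := Function.update m.arr a (Function.update (m.arr a) (m.reg x) (m.reg y)) }

/-- Programs: elementary instructions combined by sequencing, branching and loops. -/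
inductive Program where
  | instr (c : Instr)
  | seq (p q : Program)
  /-- `if x ≠ 0 then p else q` -/
  | ite (x : ℕ) (p q : Program)
  /-- `while x ≠ 0 do p` -/
  | loop (x : ℕ) (p : Program)

/-- `Runs p m t m'`: started with memory `m`, the program `p` halts after exactly `t` steps with
memory `m'`. Every elementary instruction and every test of a register counts as one step. -/
inductive Runs : Program → Memory → ℕ → Memory → Prop where
  | instr (c : Instr) (m : Memory) : Runs (.instr c) m 1 (c.exec m)
  | seq {p q : Program} {m₁ m₂ m₃ : Memory} {s t : ℕ} :
      Runs p m₁ s m₂ → Runs q m₂ t m₃ → Runs (.seq p q) m₁ (s + t) m₃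
  | ite_true {x : ℕ} {p q : Program} {m m' : Memory} {t : ℕ} :
      m.reg x ≠ 0 → Runs p m t m' → Runs (.ite x p q) m (t + 1) m'
  | ite_false {x : ℕ} {p q : Program} {m m' : Memory} {t : ℕ} :
      m.reg x = 0 → Runs q m t m' → Runs (.ite x p q) m (t + 1) m'
  | loop_done {x : ℕ} {p : Program} {m : Memory} :
      m.reg x = 0 → Runs (.loop x p) m 1 m
  | loop_again {x : ℕ} {p : Program} {m₁ m₂ m₃ : Memory} {s t : ℕ} :
      m₁.reg x ≠ 0 → Runs p m₁ s m₂ → Runs (.loop x p) m₂ t m₃ →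
        Runs (.loop x p) m₁ (s + t + 1) m₃

open Classical in
/-- The initial memory for a graph on the vertices `0, …, n - 1`: register `0` holds `n`, array `0`
holds the adjacency matrix row by row (the entry for `(u, v)` is in cell `u * n + v`), and
everything else is `0`. -/
noncomputable def input {n : ℕ} (G : SimpleGraph (Fin n)) : Memory where
  reg := Function.update (fun _ => 0) 0 n
  arr := Function.update (fun _ _ => 0) 0
    (fun i => if ∃ u v : Fin n, i = u.val * n + v.val ∧ G.Adj u v then 1 else 0)

/-- The vertex set that a final memory encodes: its indicator vector is in array `1`. -/
def output (n : ℕ) (m : Memory) : Finset (Fin n) :=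
  Finset.univ.filter fun v => m.arr 1 v.val ≠ 0

end RAM

/-- A maximum independent set can be found in polynomial time for graphs in the class `C`: there is
one program, and a polynomial in the number `n` of vertices bounding its number of steps, such that
the program started on the adjacency matrix of a graph in `C` halts within this bound and its output
is an independent set of maximum cardinality. -/
def MaxIndepSetInPolyTime (C : ∀ {n : ℕ}, SimpleGraph (Fin n) → Prop) : Prop :=
  ∃ (P : RAM.Program) (T : Polynomial ℕ), ∀ (n : ℕ) (G : SimpleGraph (Fin n)), C G →
    ∃ (t : ℕ) (m : RAM.Memory), RAM.Runs P (RAM.input G) t m ∧ t ≤ T.eval n ∧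
      G.IsMaximumIndepSet (RAM.output n m)

namespace RAM

/-! ### Reasoning about programs: protected memory, time bounds, counting loops -/

/-- The memories `m` and `m'` have the same registers and arrays with names below `k`. -/
def Agree (k : ℕ) (m m' : Memory) : Prop :=
  ∀ x < k, m'.reg x = m.reg x ∧ m'.arr x = m.arr x

namespace Agree

variable {k k' : ℕ} {m m₁ m₂ : Memory}

theorem refl (k : ℕ) (m : Memory) : Agree k m m := fun _ _ => ⟨rfl, rfl⟩

theorem trans (h : Agree k m m₁) (h' : Agree k m₁ m₂) : Agree k m m₂ := fun x hx =>
  ⟨(h' x hx).1.trans (h x hx).1, (h' x hx).2.trans (h x hx).2⟩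

theorem mono (h : Agree k m m₁) (hk : k' ≤ k) : Agree k' m m₁ := fun x hx => h x (hx.trans_le hk)

theorem reg (h : Agree k m m₁) {x : ℕ} (hx : x < k) : m₁.reg x = m.reg x := (h x hx).1

theorem arr (h : Agree k m m₁) {x : ℕ} (hx : x < k) : m₁.arr x = m.arr x := (h x hx).2

theorem update_reg (k : ℕ) (m : Memory) {x : ℕ} (hx : k ≤ x) (c : ℕ) :
    Agree k m { m with reg := Function.update m.reg x c } := fun y hy =>
  ⟨Function.update_of_ne (by omega) _ _, rfl⟩

theorem update_arr (k : ℕ) (m : Memory) {x : ℕ} (hx : k ≤ x) (c : ℕ → ℕ) :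
    Agree k m { m with arr := Function.update m.arr x c } := fun y hy =>
  ⟨rfl, Function.update_of_ne (by omega) _ _⟩

end Agree

/-- `Reaches p m t Q`: started with memory `m`, the program `p` halts within `t` steps with a memory
satisfying `Q`. -/
def Reaches (p : Program) (m : Memory) (t : ℕ) (Q : Memory → Prop) : Prop :=
  ∃ s m', Runs p m s m' ∧ s ≤ t ∧ Q m'

namespace Reaches

variable {p q : Program} {m : Memory} {s t : ℕ} {Q R : Memory → Prop}

theorem instr (c : Instr) (h : Q (c.exec m)) : Reaches (.instr c) m 1 Q :=
  ⟨1, _, .instr c m, le_rfl, h⟩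

theorem seq (h : Reaches p m s Q) (h' : ∀ m', Q m' → Reaches q m' t R) :
    Reaches (.seq p q) m (s + t) R := by
  obtain ⟨s', m₁, hr, hs, hQ⟩ := h
  obtain ⟨t', m₂, hr', ht, hR⟩ := h' m₁ hQ
  exact ⟨_, m₂, hr.seq hr', by omega, hR⟩

theorem ite {x : ℕ} (h : m.reg x ≠ 0 → Reaches p m s Q) (h' : m.reg x = 0 → Reaches q m t Q) :
    Reaches (.ite x p q) m (s + t + 1) Q := by
  by_cases hx : m.reg x = 0
  · obtain ⟨t', m₂, hr, ht, hR⟩ := h' hx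
    exact ⟨_, m₂, .ite_false hx hr, by omega, hR⟩
  · obtain ⟨t', m₂, hr, ht, hR⟩ := h hx
    exact ⟨_, m₂, .ite_true hx hr, by omega, hR⟩

theorem mono (h : Reaches p m s Q) (hst : s ≤ t) (hQ : ∀ m', Q m' → R m') : Reaches p m t R := by
  obtain ⟨s', m₁, hr, hs, h1⟩ := h
  exact ⟨s', m₁, hr, hs.trans hst, hQ _ h1⟩

end Reaches

/-- Run `p` with register `k + 1` set to `0, 1, …, N - 1`, where `N` is the content of register
`k + 3`; register `k + 2` is used for the test. -/
def forLoop (k : ℕ) (p : Program) : Program :=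
  .seq (.instr (.const (k + 1) 0)) (.seq (.instr (.sub (k + 2) (k + 3) (k + 1)))
    (.loop (k + 2) (.seq p (.seq (.instr (.const (k + 2) 1))
      (.seq (.instr (.add (k + 1) (k + 1) (k + 2))) (.instr (.sub (k + 2) (k + 3) (k + 1))))))))

/-- The loop itself writes only registers `r + 1` and `r + 2`, so the invariant has to be
insensitive to these. One round costs `t` for the body, three instructions and a test; two initial
instructions and the last test give the `3`. -/
theorem Reaches.forLoop_of_stable {r N t : ℕ} {p : Program} {m₀ : Memory} (J : ℕ → Memory → Prop)
    (hJ : ∀ a m m', m'.arr = m.arr → (∀ x, x ≠ r + 1 → x ≠ r + 2 → m'.reg x = m.reg x) →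
      J a m → J a m')
    (hN : m₀.reg (r + 3) = N) (h0 : J 0 m₀)
    (hp : ∀ a < N, ∀ m, m.reg (r + 1) = a → m.reg (r + 3) = N → J a m →
      Reaches p m t fun m' => m'.reg (r + 1) = a ∧ m'.reg (r + 3) = N ∧ J (a + 1) m') :
    Reaches (forLoop r p) m₀ (N * (t + 4) + 3) (J N) := by
  -- The test register holds the number `b` of remaining rounds.
  have key : ∀ b a, a + b = N → ∀ m, m.reg (r + 1) = a → m.reg (r + 2) = b →
      m.reg (r + 3) = N → J a m →
      Reaches (.loop (r + 2) (.seq p (.seq (.instr (.const (r + 2) 1))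
        (.seq (.instr (.add (r + 1) (r + 1) (r + 2))) (.instr (.sub (r + 2) (r + 3) (r + 1)))))))
        m (b * (t + 4) + 1) (J N) := by
    intro b
    induction b with
    | zero =>
      intro a ha m h1 h2 h3 hm
      obtain rfl : a = N := by omega
      exact ⟨1, m, .loop_done h2, by omega, hm⟩
    | succ b ih =>
      intro a ha m h1 h2 h3 hm
      obtain ⟨s, m₁, hr, hs, h1', h3', hm'⟩ := hp a (by omega) m h1 h3 hm
      obtain ⟨s', m₂, hr', hs', hQ⟩ := ih (a + 1) (by omega)
        ((Instr.sub (r + 2) (r + 3) (r + 1)).exec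
          ((Instr.add (r + 1) (r + 1) (r + 2)).exec ((Instr.const (r + 2) 1).exec m₁)))
        (by simp [Instr.exec, h1'])
        (by simp [Instr.exec, h1', h3']; omega)
        (by simp [Instr.exec, h3'])
        (hJ _ m₁ _ rfl (fun x hx hx' => by simp [Instr.exec, hx, hx']) hm')
      refine ⟨_, m₂, .loop_again (by omega)
        (hr.seq ((Runs.instr _ _).seq ((Runs.instr _ _).seq (Runs.instr _ _)))) hr', ?_, hQ⟩
      linarith
  refine Reaches.mono (Reaches.seq (Reaches.instr _ rfl) fun m' hm' => Reaches.seq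
    (Reaches.instr _ rfl) fun m'' hm'' => key N 0 (by omega) m'' ?_ ?_ ?_ ?_) (by omega)
    (fun _ h => h)
  · subst hm'' hm'
    simp [Instr.exec]
  · subst hm'' hm'
    simp [Instr.exec, hN]
  · subst hm'' hm'
    simp [Instr.exec, hN]
  · subst hm'' hm'
    exact hJ _ m₀ _ rfl (fun x hx hx' => by simp [Instr.exec, hx, hx']) h0

theorem Reaches.forLoop {k N t : ℕ} {p : Program} {m₀ : Memory} (J : ℕ → ℕ → (ℕ → ℕ) → Prop)
    (hN : m₀.reg (k + 3) = N) (h0 : J 0 (m₀.reg k) (m₀.arr k))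
    (hp : ∀ a < N, ∀ m, Agree k m₀ m → m.reg (k + 1) = a → m.reg (k + 3) = N →
      J a (m.reg k) (m.arr k) → Reaches p m t fun m' =>
        Agree k m₀ m' ∧ m'.reg (k + 1) = a ∧ m'.reg (k + 3) = N ∧ J (a + 1) (m'.reg k) (m'.arr k)) :
    Reaches (forLoop k p) m₀ (N * (t + 4) + 3) fun m' =>
      Agree k m₀ m' ∧ J N (m'.reg k) (m'.arr k) := by
  refine Reaches.forLoop_of_stable (fun a m => Agree k m₀ m ∧ J a (m.reg k) (m.arr k)) ?_ hN
    ⟨.refl _ _, h0⟩ fun a ha m h1 h3 hm => (hp a ha m hm.1 h1 h3 hm.2).mono le_rfl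
      fun m' h => ⟨h.2.1, h.2.2.1, h.1, h.2.2.2⟩
  intro a m m' harr hreg hm
  rw [harr, hreg k (by omega) (by omega)]
  exact ⟨fun x hx => ⟨(hreg x (by omega) (by omega)).trans (hm.1 x hx).1,
    (congrFun harr x).trans (hm.1 x hx).2⟩, hm.2⟩

/-! ### Uniform polynomial-time computability of numbers and arrays -/

/-- A typing context for uniform computations: a family of situations, called worlds, each of which
comes with a graph, together with a description of how a world is laid out in the part of the memory
with names below `bound`. -/
structure Context where
  World : Type
  size : World → ℕ
  graph : ∀ w, SimpleGraph (Fin (size w))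
  bound : ℕ
  Holds : World → Memory → Prop
  bound_pos : 0 < bound
  congr : ∀ {w m m'}, Agree bound m m' → Holds w m → Holds w m'
  reg_zero : ∀ {w m}, Holds w m → m.reg 0 = size w
  arr_zero : ∀ {w m}, Holds w m → ∀ u v : Fin (size w),
    (m.arr 0 (u.val * size w + v.val) ≠ 0 ↔ (graph w).Adj u v)

namespace Context

/-- `Q k` can be established in polynomial time without changing the memory below `k`. -/
def Establishes (C : Context) (Q : ℕ → C.World → Memory → Prop) : Prop :=
  ∀ k ≥ C.bound, ∃ (p : Program) (T : Polynomial ℕ), ∀ w m, C.Holds w m →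
    Reaches p m (T.eval (C.size w)) fun m' => Agree k m m' ∧ Q k w m'

/-- The number `f w` is computable in polynomial time. -/
def NatComp (C : Context) (f : C.World → ℕ) : Prop :=
  C.Establishes fun k w m => m.reg k = f w

/-- The array `F w` is computable in polynomial time. -/
def ArrComp (C : Context) (F : ∀ w, Fin (C.size w) → ℕ) : Prop :=
  C.Establishes fun k w m => ∀ v : Fin (C.size w), m.arr k v.val = F w v

/-- The context `C` with an additional variable. -/
@[reducible] def extend (C : Context) (E : C.World → Type) (b : ℕ) (hb : C.bound ≤ b)
    (R : ∀ w, E w → Memory → Prop)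
    (hR : ∀ w e m m', Agree b m m' → R w e m → R w e m') : Context where
  World := Σ w, E w
  size w := C.size w.1
  graph w := C.graph w.1
  bound := b
  Holds w m := C.Holds w.1 m ∧ R w.1 w.2 m
  bound_pos := C.bound_pos.trans_le hb
  congr h h' := ⟨C.congr (h.mono hb) h'.1, hR _ _ _ _ h h'.2⟩
  reg_zero h := C.reg_zero h.1
  arr_zero h := C.arr_zero h.1

/-- The context `C` with an additional vertex, stored in register `j`. -/
@[reducible] def addVertex (C : Context) (j : ℕ) (hj : C.bound ≤ j) : Context :=
  C.extend (fun w => Fin (C.size w)) (j + 1) (by omega) (fun _ v m => m.reg j = v.val)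
    (fun _ _ _ _ h h' => (h.reg (by omega)).trans h')

/-- The context `C` with an additional number below `N w` in register `j + 1`, and an additional
object that is encoded as an array, in array `j`. -/
@[reducible] def addState (C : Context) (σ : C.World → Type)
    (enc : ∀ w, σ w → Fin (C.size w) → ℕ) (N : C.World → ℕ) (j : ℕ) (hj : C.bound ≤ j) : Context :=
  C.extend (fun w => σ w × Fin (N w)) (j + 2) (by omega)
    (fun w e m => (∀ v : Fin (C.size w), m.arr j v.val = enc w e.1 v) ∧ m.reg (j + 1) = e.2.val)
    (fun _ _ _ _ h h' => ⟨fun v => (congrFun (h.arr (by omega)) _).trans (h'.1 v),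
      (h.reg (by omega)).trans h'.2⟩)

variable {C : Context}

section Weakening

variable {E : C.World → Type} {b : ℕ} {hb : C.bound ≤ b} {R : ∀ w, E w → Memory → Prop}
  {hR : ∀ w e m m', Agree b m m' → R w e m → R w e m'}

theorem NatComp.weaken {f : C.World → ℕ} (hf : C.NatComp f) :
    (C.extend E b hb R hR).NatComp fun w => f w.1 := by
  intro k hk
  obtain ⟨p, T, h⟩ := hf k (hb.trans hk)
  exact ⟨p, T, fun w m hm => h w.1 m hm.1⟩

theorem ArrComp.weaken {F : ∀ w, Fin (C.size w) → ℕ} (hF : C.ArrComp F) :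
    (C.extend E b hb R hR).ArrComp fun w => F w.1 := by
  intro k hk
  obtain ⟨p, T, h⟩ := hF k (hb.trans hk)
  exact ⟨p, T, fun w m hm => h w.1 m hm.1⟩

end Weakening

theorem NatComp.vertex {j : ℕ} {hj : C.bound ≤ j} :
    (C.addVertex j hj).NatComp fun w => w.2.val := by
  intro k hk
  refine ⟨.instr (.move k j), 1, fun w m hm => ?_⟩
  simp only [Polynomial.eval_one]
  refine Reaches.instr _ ⟨Agree.update_reg k _ le_rfl _, ?_⟩
  simpa [Instr.exec] using hm.2

section State

variable {σ : C.World → Type} {enc : ∀ w, σ w → Fin (C.size w) → ℕ} {N : C.World → ℕ} {j : ℕ}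
  {hj : C.bound ≤ j}

theorem NatComp.index : (C.addState σ enc N j hj).NatComp fun w => w.2.2.val := by
  intro k hk
  refine ⟨.instr (.move k (j + 1)), 1, fun w m hm => ?_⟩
  simp only [Polynomial.eval_one]
  refine Reaches.instr _ ⟨Agree.update_reg k _ le_rfl _, ?_⟩
  simpa [Instr.exec] using hm.2.2

end State

theorem NatComp.const (c : ℕ) : C.NatComp fun _ => c := by
  intro k hk
  refine ⟨.instr (.const k c), 1, fun w m hm => ?_⟩
  simp only [Polynomial.eval_one]
  refine Reaches.instr _ ⟨Agree.update_reg k _ le_rfl _, ?_⟩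
  simp [Instr.exec]

theorem NatComp.size : C.NatComp fun w => C.size w := by
  intro k hk
  refine ⟨.instr (.move k 0), 1, fun w m hm => ?_⟩
  simp only [Polynomial.eval_one]
  refine Reaches.instr _ ⟨Agree.update_reg k _ le_rfl _, ?_⟩
  simpa [Instr.exec] using C.reg_zero hm

/-- The second operand is computed with base `k + 1`, so the first one survives in register `k`. -/
theorem NatComp.instr₂ (c : ℕ → ℕ → ℕ → Instr) (op : ℕ → ℕ → ℕ)
    (hc : ∀ x y z m, (c x y z).exec m =
      { m with reg := Function.update m.reg x (op (m.reg y) (m.reg z)) })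
    {f g : C.World → ℕ} (hf : C.NatComp f) (hg : C.NatComp g) :
    C.NatComp fun w => op (f w) (g w) := by
  intro k hk
  obtain ⟨p, S, hp⟩ := hf k hk
  obtain ⟨q, T, hq⟩ := hg (k + 1) (by omega)
  refine ⟨.seq p (.seq q (.instr (c k k (k + 1)))), S + (T + 1), fun w m hm => ?_⟩
  simp only [Polynomial.eval_add, Polynomial.eval_one]
  refine (hp w m hm).seq fun m₁ h₁ => (hq w m₁ (C.congr (h₁.1.mono hk) hm)).seq fun m₂ h₂ =>
    Reaches.instr _ ?_
  rw [hc]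
  refine ⟨(h₁.1.trans (h₂.1.mono (by omega))).trans (Agree.update_reg k _ le_rfl _), ?_⟩
  have := h₂.1.reg (Nat.lt_succ_self k)
  simp [h₂.2, this, h₁.2]

theorem NatComp.add {f g : C.World → ℕ} (hf : C.NatComp f) (hg : C.NatComp g) :
    C.NatComp fun w => f w + g w :=
  .instr₂ .add (· + ·) (fun _ _ _ _ => rfl) hf hg

theorem NatComp.sub {f g : C.World → ℕ} (hf : C.NatComp f) (hg : C.NatComp g) :
    C.NatComp fun w => f w - g w :=
  .instr₂ .sub (· - ·) (fun _ _ _ _ => rfl) hf hg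

theorem NatComp.ite_ne_zero {c f g : C.World → ℕ} (hc : C.NatComp c) (hf : C.NatComp f)
    (hg : C.NatComp g) : C.NatComp fun w => if c w ≠ 0 then f w else g w := by
  intro k hk
  obtain ⟨p, S, hp⟩ := hc k hk
  obtain ⟨q, T, hq⟩ := hf k hk
  obtain ⟨r, U, hr⟩ := hg k hk
  refine ⟨.seq p (.ite k q r), S + (T + U + 1), fun w m hm => ?_⟩
  simp only [Polynomial.eval_add, Polynomial.eval_one]
  refine (hp w m hm).seq fun m₁ h₁ => ?_
  have hm₁ := C.congr (h₁.1.mono hk) hm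
  refine Reaches.ite (fun h => ?_) (fun h => ?_)
  · refine (hq w m₁ hm₁).mono le_rfl fun m₂ h₂ => ⟨h₁.1.trans h₂.1, ?_⟩
    rw [h₂.2, if_pos (by rwa [h₁.2] at h)]
  · refine (hr w m₁ hm₁).mono le_rfl fun m₂ h₂ => ⟨h₁.1.trans h₂.1, ?_⟩
    rw [h₂.2, if_neg (by rw [h₁.2] at h; simpa using h)]

theorem NatComp.get {F : ∀ w, Fin (C.size w) → ℕ} {v : ∀ w, Fin (C.size w)} (hF : C.ArrComp F)
    (hv : C.NatComp fun w => (v w).val) : C.NatComp fun w => F w (v w) := by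
  intro k hk
  obtain ⟨p, S, hp⟩ := hF k hk
  obtain ⟨q, T, hq⟩ := hv (k + 1) (by omega)
  refine ⟨.seq p (.seq q (.instr (.load k k (k + 1)))), S + (T + 1), fun w m hm => ?_⟩
  simp only [Polynomial.eval_add, Polynomial.eval_one]
  refine (hp w m hm).seq fun m₁ h₁ => (hq w m₁ (C.congr (h₁.1.mono hk) hm)).seq fun m₂ h₂ =>
    Reaches.instr _
      ⟨(h₁.1.trans (h₂.1.mono (by omega))).trans (Agree.update_reg k _ le_rfl _), ?_⟩
  have := h₂.1.arr (Nat.lt_succ_self k)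
  simp [Instr.exec, h₂.2, this, h₁.2]

theorem NatComp.sum {f : ∀ w, Fin (C.size w) → ℕ}
    (hf : ∀ j hj, (C.addVertex j hj).NatComp fun w => f w.1 w.2) :
    C.NatComp fun w => ∑ v, f w v := by
  intro k hk
  -- The loop counter in register `k + 1` serves as the vertex variable; base `k + 4` protects the
  -- accumulator and the control registers of the loop.
  obtain ⟨p, S, hp⟩ := hf (k + 1) (by omega) (k + 4) (by simp)
  refine ⟨.seq (.instr (.const k 0)) (.seq (.instr (.move (k + 3) 0))
    (forLoop k (.seq p (.instr (.add k k (k + 4)))))),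
    1 + (1 + (.X * (S + 1 + 4) + 3)), fun w m hm => ?_⟩
  simp only [Polynomial.eval_add, Polynomial.eval_one, Polynomial.eval_mul, Polynomial.eval_X,
    Polynomial.eval_ofNat]
  refine (Reaches.instr _ rfl).seq fun m₁ h₁ => (Reaches.instr _ rfl).seq fun m₂ h₂ => ?_
  have h0 : Agree k m m₂ := by
    rw [← h₂, ← h₁]
    exact (Agree.update_reg k _ (by omega) _).trans (Agree.update_reg k _ (by omega) _)
  have hbp := C.bound_pos
  have hz := C.reg_zero hm
  refine (Reaches.forLoop (N := C.size w) (t := S.eval (C.size w) + 1)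
    (fun a x _ => x = ∑ v with v.val < a, f w v) ?_ ?_ ?_).mono le_rfl ?_
  · rw [← h₂, ← h₁]
    simp [Instr.exec, show (0 : ℕ) ≠ k by omega, hz]
  · rw [← h₂, ← h₁]
    simp [Instr.exec]
  · intro a ha m₃ h₃ h₃i h₃N h₃s
    have hm₃ := C.congr ((h0.trans h₃).mono hk) hm
    refine (hp ⟨w, ⟨a, ha⟩⟩ m₃ ⟨hm₃, h₃i⟩).seq fun m₄ h₄ => Reaches.instr _ ⟨?_, ?_, ?_, ?_⟩
    · exact (h₃.trans (h₄.1.mono (by omega))).trans (Agree.update_reg k _ le_rfl _)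
    · simp [Instr.exec, h₄.1.reg, h₃i]
    · simp [Instr.exec, h₄.1.reg, h₃N]
    · have hins : (Finset.univ.filter fun v : Fin (C.size w) => v.val < a + 1) =
          insert ⟨a, ha⟩ (Finset.univ.filter fun v => v.val < a) := by
        ext v; simp [Fin.ext_iff]; omega
      rw [hins, Finset.sum_insert (by simp)]
      simp [Instr.exec, h₄.1.reg (show k < k + 4 by omega), h₃s, h₄.2, add_comm]
  · rintro m' ⟨h, hs⟩
    exact ⟨h0.trans h, by simpa using hs⟩

theorem ArrComp.tabulate {F : ∀ w, Fin (C.size w) → ℕ}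
    (hF : ∀ j hj, (C.addVertex j hj).NatComp fun w => F w.1 w.2) : C.ArrComp F := by
  intro k hk
  obtain ⟨p, S, hp⟩ := hF (k + 1) (by omega) (k + 4) (by simp)
  refine ⟨.seq (.instr (.move (k + 3) 0)) (forLoop k (.seq p (.instr (.store k (k + 1) (k + 4))))),
    1 + (.X * (S + 1 + 4) + 3), fun w m hm => ?_⟩
  simp only [Polynomial.eval_add, Polynomial.eval_one, Polynomial.eval_mul, Polynomial.eval_X,
    Polynomial.eval_ofNat]
  refine (Reaches.instr _ rfl).seq fun m₂ h₂ => ?_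
  have h0 : Agree k m m₂ := by
    rw [← h₂]
    exact Agree.update_reg k _ (by omega) _
  have hz := C.reg_zero hm
  refine (Reaches.forLoop (N := C.size w) (t := S.eval (C.size w) + 1)
    (fun a _ x => ∀ v : Fin (C.size w), v.val < a → x v.val = F w v) ?_ ?_ ?_).mono le_rfl ?_
  · rw [← h₂]
    simp [Instr.exec, hz]
  · simp
  · intro a ha m₃ h₃ h₃i h₃N h₃s
    have hm₃ := C.congr ((h0.trans h₃).mono hk) hm
    refine (hp ⟨w, ⟨a, ha⟩⟩ m₃ ⟨hm₃, h₃i⟩).seq fun m₄ h₄ => Reaches.instr _ ⟨?_, ?_, ?_, ?_⟩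
    · exact (h₃.trans (h₄.1.mono (by omega))).trans (Agree.update_arr k _ le_rfl _)
    · simp [Instr.exec, h₄.1.reg, h₃i]
    · simp [Instr.exec, h₄.1.reg, h₃N]
    · intro v hv
      have e1 := h₄.1.reg (show k + 1 < k + 4 by omega)
      have e2 := h₄.1.arr (show k < k + 4 by omega)
      rcases eq_or_ne v.val a with h | h
      · subst h
        simp [Instr.exec, e1, h₃i, h₄.2]
      · simp [Instr.exec, e1, h₃i, e2, h, h₃s v (by omega)]
  · rintro m' ⟨h, hs⟩
    exact ⟨h0.trans h, fun v => hs v v.2⟩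

/-- Copy the first entries of array `k + 4` to array `k`; their number is given by register `0`. -/
def copy (k : ℕ) : Program :=
  .seq (.instr (.move (k + 7) 0)) (forLoop (k + 4) (.seq (.instr (.load (k + 8) (k + 4) (k + 5)))
    (.instr (.store k (k + 5) (k + 8)))))

/-- The copying loop lives at base `k + 4`, so the control registers of a surrounding loop at base
`k` survive. As array `k` lies below that base and changes, the general loop rule is needed. -/
theorem Reaches.copy (k : ℕ) (m : Memory) :
    Reaches (copy k) m (1 + (m.reg 0 * (1 + 1 + 4) + 3)) fun m' => Agree k m m' ∧
      (∀ x < k + 4, m'.reg x = m.reg x) ∧ ∀ i < m.reg 0, m'.arr k i = m.arr (k + 4) i := by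
  refine (Reaches.instr _ rfl).seq fun m₁ h₁ => ?_
  refine (Reaches.forLoop_of_stable (N := m.reg 0) (fun a m' => (∀ x < k + 4, m'.reg x = m.reg x) ∧
    (∀ x < k, m'.arr x = m.arr x) ∧ m'.arr (k + 4) = m.arr (k + 4) ∧
    ∀ i < a, m'.arr k i = m.arr (k + 4) i) ?_ ?_ ?_ ?_).mono le_rfl ?_
  · rintro a m' m'' harr hreg ⟨h1, h2, h3, h4⟩
    refine ⟨fun x hx => (hreg x (by omega) (by omega)).trans (h1 x hx), ?_⟩
    rw [harr]
    exact ⟨h2, h3, h4⟩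
  · simp [← h₁, Instr.exec]
  · refine ⟨fun x hx => ?_, ?_⟩
    · simp [← h₁, Instr.exec, show x ≠ k + 7 by omega]
    · simp [← h₁, Instr.exec]
  · rintro a ha m₂ h1 h3 ⟨hr, hx, hk, hi⟩
    refine (Reaches.instr _ rfl).seq fun m₃ h₃ => Reaches.instr _ ?_
    subst h₃
    simp only [Instr.exec, Function.update_self] at *
    refine ⟨by simp [h1], by simp [h3], fun x hx => ?_, fun x hx' => ?_, ?_, fun i hi' => ?_⟩
    · simp [show x ≠ k + 8 by omega, hr x hx]
    · simp [show x ≠ k by omega, hx x hx']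
    · simp [hk]
    · rcases eq_or_ne i a with rfl | h
      · simp [h1, hk]
      · simp [h1, h, hi i (by omega)]
  · rintro m' ⟨h1, h2, h3, h4⟩
    exact ⟨fun x hx => ⟨h1 x (by omega), h2 x hx⟩, h1, h4⟩

/-- The body may still read the old state from array `k` while it produces the new one, so the new
state is built in array `k + 4` and copied afterwards. The number of rounds needs a polynomial bound
`B`, since computability alone does not bound its value polynomially in the size. -/
theorem ArrComp.foldl {σ : C.World → Type} {enc : ∀ w, σ w → Fin (C.size w) → ℕ}
    {N : C.World → ℕ} (hN : C.NatComp N) (B : Polynomial ℕ) (hB : ∀ w, N w ≤ B.eval (C.size w))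
    {init : ∀ w, σ w} (hinit : C.ArrComp fun w => enc w (init w))
    {body : ∀ w, σ w → Fin (N w) → σ w}
    (hbody : ∀ j hj, (C.addState σ enc N j hj).ArrComp fun w =>
      enc w.1 (body w.1 w.2.1 w.2.2)) :
    C.ArrComp fun w => enc w ((List.finRange (N w)).foldl (body w) (init w)) := by
  intro k hk
  obtain ⟨p, S, hp⟩ := hinit k hk
  obtain ⟨q, T, hq⟩ := hN (k + 3) (by omega)
  -- The layout of `addState` at `k` matches the loop: state in array `k`, index in the counter
  -- register `k + 1`.
  obtain ⟨r, U, hr⟩ := hbody k hk (k + 4) (by simp)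
  refine ⟨.seq p (.seq q (forLoop k (.seq r (copy k)))),
    S + (T + (B * (U + (1 + (.X * (1 + 1 + 4) + 3)) + 4) + 3)), fun w m hm => ?_⟩
  simp only [Polynomial.eval_add, Polynomial.eval_one, Polynomial.eval_mul, Polynomial.eval_X,
    Polynomial.eval_ofNat]
  refine (hp w m hm).seq fun m₁ h₁ => ?_
  have hm₁ := C.congr (h₁.1.mono hk) hm
  refine (hq w m₁ hm₁).seq fun m₂ h₂ => ?_
  have h02 : Agree k m m₂ := h₁.1.trans (h₂.1.mono (by omega))
  refine (Reaches.forLoop (N := N w)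
    (fun a _ x => ∀ v : Fin (C.size w),
      x v.val = enc w (((List.finRange (N w)).take a).foldl (body w) (init w)) v)
    h₂.2 ?_ ?_).mono (by gcongr; exact hB w) ?_
  · intro v
    rw [h₂.1.arr (by omega)]
    simpa using h₁.2 v
  · intro a ha m₃ h₃ h₃i h₃N h₃s
    have hm₃ := C.congr ((h02.trans h₃).mono hk) hm
    refine (hr ⟨w, _, ⟨a, ha⟩⟩ m₃ ⟨hm₃, h₃s, h₃i⟩).seq fun m₄ h₄ => ?_
    have hz : m₄.reg 0 = C.size w := (h₄.1.reg (by omega)).trans (C.reg_zero hm₃)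
    refine (Reaches.copy k m₄).mono (by rw [hz]) ?_
    rintro m₅ ⟨h1, h2, h3⟩
    refine ⟨(h₃.trans (h₄.1.mono (by omega))).trans h1, ?_, ?_, fun v => ?_⟩
    · rw [h2 _ (by omega), h₄.1.reg (by omega), h₃i]
    · rw [h2 _ (by omega), h₄.1.reg (by omega), h₃N]
    · rw [h3 _ (by rw [hz]; exact v.2), h₄.2 v,
        ← List.take_append_getElem (by simpa using ha), List.foldl_append]
      simp
  · rintro m' ⟨h, hs⟩
    refine ⟨h02.trans h, fun v => ?_⟩
    rw [hs v, List.take_of_length_le (by simp)]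

section State

variable {σ : C.World → Type} {enc : ∀ w, σ w → Fin (C.size w) → ℕ} {N : C.World → ℕ} {j : ℕ}
  {hj : C.bound ≤ j}

theorem ArrComp.state : (C.addState σ enc N j hj).ArrComp fun w => enc w.1 w.2.1 := by
  refine ArrComp.tabulate fun i hi k hk => ?_
  have hji : j + 2 ≤ i := hi
  have hik : i + 1 ≤ k := hk
  refine ⟨.seq (.instr (.move k i)) (.instr (.load k j k)), 1 + 1, fun w m hm => ?_⟩
  simp only [Polynomial.eval_add, Polynomial.eval_one]
  refine (Reaches.instr _ rfl).seq fun m₁ h₁ => Reaches.instr _ ?_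
  subst h₁
  refine ⟨(Agree.update_reg k _ le_rfl _).trans (Agree.update_reg k _ le_rfl _), ?_⟩
  have h2 := hm.1.2.1 w.2
  have h3 : m.reg i = w.2.val := hm.2
  simpa [Instr.exec, h3] using h2

end State

/-! ### Decidable properties and computable vertex sets -/

/-- The proposition `p w` can be decided in polynomial time. -/
def PropComp (C : Context) (p : C.World → Prop) : Prop :=
  ∃ f, C.NatComp f ∧ ∀ w, f w ≠ 0 ↔ p w

open Classical in
/-- The indicator of a finite set of vertices. -/
noncomputable def indicator {n : ℕ} (S : Finset (Fin n)) (v : Fin n) : ℕ := if v ∈ S then 1 else 0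

/-- The set of vertices `S w` is computable in polynomial time. -/
def FinsetComp (C : Context) (S : ∀ w, Finset (Fin (C.size w))) : Prop :=
  C.ArrComp fun w => indicator (S w)

theorem NatComp.congr {f g : C.World → ℕ} (hf : C.NatComp f) (h : ∀ w, g w = f w) :
    C.NatComp g := by
  rwa [funext h]

theorem PropComp.congr {p q : C.World → Prop} (hp : C.PropComp p) (h : ∀ w, q w ↔ p w) :
    C.PropComp q := by
  rwa [funext fun w => propext (h w)]

section Weakening

variable {E : C.World → Type} {b : ℕ} {hb : C.bound ≤ b} {R : ∀ w, E w → Memory → Prop}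
  {hR : ∀ w e m m', Agree b m m' → R w e m → R w e m'}

theorem PropComp.weaken {p : C.World → Prop} (hp : C.PropComp p) :
    (C.extend E b hb R hR).PropComp fun w => p w.1 := by
  obtain ⟨f, hf, h⟩ := hp
  exact ⟨_, hf.weaken, fun w => h w.1⟩

theorem FinsetComp.weaken {S : ∀ w, Finset (Fin (C.size w))} (hS : C.FinsetComp S) :
    (C.extend E b hb R hR).FinsetComp fun w => S w.1 :=
  ArrComp.weaken hS

end Weakening

theorem PropComp.ne_zero {f : C.World → ℕ} (hf : C.NatComp f) : C.PropComp fun w => f w ≠ 0 :=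
  ⟨f, hf, fun _ => Iff.rfl⟩

theorem NatComp.ite {p : C.World → Prop} {inst : ∀ w, Decidable (p w)} {f g : C.World → ℕ}
    (hp : C.PropComp p) (hf : C.NatComp f) (hg : C.NatComp g) :
    C.NatComp fun w => if p w then f w else g w := by
  obtain ⟨c, hc, h⟩ := hp
  exact (NatComp.ite_ne_zero hc hf hg).congr fun w => by simp only [h w]

theorem PropComp.not {p : C.World → Prop} (hp : C.PropComp p) : C.PropComp fun w => ¬ p w := by
  obtain ⟨c, hc, h⟩ := hp
  exact ⟨_, (NatComp.const 1).sub hc, fun w =>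
    (show 1 - c w ≠ 0 ↔ ¬ (c w ≠ 0) by omega).trans (not_congr (h w))⟩

theorem PropComp.or {p q : C.World → Prop} (hp : C.PropComp p) (hq : C.PropComp q) :
    C.PropComp fun w => p w ∨ q w := by
  obtain ⟨c, hc, h⟩ := hp
  obtain ⟨d, hd, h'⟩ := hq
  exact ⟨_, hc.add hd, fun w =>
    (show c w + d w ≠ 0 ↔ c w ≠ 0 ∨ d w ≠ 0 by omega).trans (or_congr (h w) (h' w))⟩

theorem PropComp.and {p q : C.World → Prop} (hp : C.PropComp p) (hq : C.PropComp q) :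
    C.PropComp fun w => p w ∧ q w :=
  (hp.not.or hq.not).not.congr fun w => by tauto

theorem PropComp.imp {p q : C.World → Prop} (hp : C.PropComp p) (hq : C.PropComp q) :
    C.PropComp fun w => p w → q w :=
  (hp.not.or hq).congr fun w => by tauto

theorem PropComp.lt {f g : C.World → ℕ} (hf : C.NatComp f) (hg : C.NatComp g) :
    C.PropComp fun w => f w < g w :=
  (PropComp.ne_zero (hg.sub hf)).congr fun w => by omega

theorem PropComp.le {f g : C.World → ℕ} (hf : C.NatComp f) (hg : C.NatComp g) :
    C.PropComp fun w => f w ≤ g w :=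
  (PropComp.lt hg hf).not.congr fun w => by omega

theorem PropComp.eq {f g : C.World → ℕ} (hf : C.NatComp f) (hg : C.NatComp g) :
    C.PropComp fun w => f w = g w :=
  ((PropComp.le hf hg).and (PropComp.le hg hf)).congr fun w => by omega

theorem PropComp.exists {p : ∀ w, Fin (C.size w) → Prop}
    (hp : ∀ j hj, (C.addVertex j hj).PropComp fun w => p w.1 w.2) :
    C.PropComp fun w => ∃ v, p w v := by
  classical
  refine ⟨_, NatComp.sum (f := fun w v => if p w v then 1 else 0) fun j hj =>
    NatComp.ite (hp j hj) (.const 1) (.const 0), fun w => ?_⟩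
  simp

theorem PropComp.forall {p : ∀ w, Fin (C.size w) → Prop}
    (hp : ∀ j hj, (C.addVertex j hj).PropComp fun w => p w.1 w.2) :
    C.PropComp fun w => ∀ v, p w v :=
  (PropComp.exists (p := fun w v => ¬ p w v) fun j hj => (hp j hj).not).not.congr
    fun w => by simp

theorem PropComp.mem {S : ∀ w, Finset (Fin (C.size w))} {v : ∀ w, Fin (C.size w)}
    (hS : C.FinsetComp S) (hv : C.NatComp fun w => (v w).val) : C.PropComp fun w => v w ∈ S w :=
  ⟨_, NatComp.get hS hv, fun w => by simp [indicator]⟩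

theorem PropComp.eq_vertex {u v : ∀ w, Fin (C.size w)} (hu : C.NatComp fun w => (u w).val)
    (hv : C.NatComp fun w => (v w).val) : C.PropComp fun w => u w = v w :=
  (PropComp.eq hu hv).congr fun _ => Fin.ext_iff

theorem FinsetComp.of_mem {S : ∀ w, Finset (Fin (C.size w))}
    (hS : ∀ j hj, (C.addVertex j hj).PropComp fun w => w.2 ∈ S w.1) : C.FinsetComp S :=
  ArrComp.tabulate fun j hj => NatComp.ite (hS j hj) (.const 1) (.const 0)

theorem FinsetComp.card {S : ∀ w, Finset (Fin (C.size w))} (hS : C.FinsetComp S) :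
    C.NatComp fun w => (S w).card := by
  classical
  refine (NatComp.sum (f := fun w v => if v ∈ S w then 1 else 0) fun j hj => ?_).congr
    fun w => by simp
  exact NatComp.ite (PropComp.mem hS.weaken .vertex) (.const 1) (.const 0)

/-- There is no multiplication instruction, so the row offset is obtained by adding the size once
for each vertex below `u`. -/
theorem PropComp.adj {u v : ∀ w, Fin (C.size w)} (hu : C.NatComp fun w => (u w).val)
    (hv : C.NatComp fun w => (v w).val) : C.PropComp fun w => (C.graph w).Adj (u w) (v w) := by
  classical
  have hmul : C.NatComp fun w => (u w).val * C.size w + v w := by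
    refine (NatComp.add (NatComp.sum (f := fun w i => if i.val < (u w).val then C.size w else 0)
      fun j hj => NatComp.ite (.lt .vertex hu.weaken) .size (.const 0)) hv).congr fun w => ?_
    rw [← Finset.sum_filter, Finset.sum_const, smul_eq_mul]
    congr
    have : (Finset.univ.filter fun i : Fin (C.size w) => i.val < (u w).val) =
        Finset.Iio (u w) := by ext; simp
    rw [this, Fin.card_Iio]
  -- A context only says whether the matrix entry is nonzero; the branch normalises it to a value
  -- determined by the world.
  have : C.NatComp fun w => if (C.graph w).Adj (u w) (v w) then 1 else 0 := by
    intro k hk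
    obtain ⟨p, T, h⟩ := hmul k hk
    refine ⟨.seq p (.seq (.instr (.load k 0 k)) (.ite k (.instr (.const k 1))
      (.instr (.const k 0)))), T + (1 + (1 + 1 + 1)), fun w m hm => ?_⟩
    simp only [Polynomial.eval_add, Polynomial.eval_one]
    refine (h w m hm).seq fun m₁ h₁ => (Reaches.instr _ rfl).seq fun m₂ h₂ => ?_
    have key : m₂.reg k ≠ 0 ↔ (C.graph w).Adj (u w) (v w) := by
      simp only [← h₂, Instr.exec, Function.update_self, h₁.2]
      exact C.arr_zero (C.congr (h₁.1.mono hk) hm) _ _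
    have hA : Agree k m m₂ := by
      rw [← h₂]
      exact h₁.1.trans (Agree.update_reg k _ le_rfl _)
    refine Reaches.ite (fun h => ?_) (fun h => ?_) <;>
      refine Reaches.instr _ ⟨hA.trans (Agree.update_reg k _ le_rfl _), ?_⟩
    · simp [Instr.exec, key.1 h]
    · simp [Instr.exec, mt key.2 (not_not.2 h)]
  exact ⟨_, this, fun w => by simp⟩

end Context

end RAM

/-! ### Iteration with an increasing bounded measure -/

/-- As long as no fixed point is reached, every step raises `μ`; `N + 1` raises would exceed the
bound. -/
theorem iterate_isFixedPt {α : Type*} {f : α → α} {P : α → Prop} (μ : α → ℕ) {N : ℕ}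
    (hP : ∀ a, P a → P (f a)) (hf : ∀ a, P a → f a = a ∨ μ a < μ (f a)) (hN : ∀ a, P a → μ a ≤ N)
    {a : α} (ha : P a) : f (f^[N + 1] a) = f^[N + 1] a ∧ P (f^[N + 1] a) := by
  have hPi : ∀ k, P (f^[k] a) := fun k => by
    induction k with
    | zero => exact ha
    | succ k ih => rw [Function.iterate_succ_apply']; exact hP _ ih
  have key : ∀ k, f (f^[k] a) = f^[k] a ∨ k ≤ μ (f^[k] a) := fun k => by
    induction k with
    | zero => exact .inr (Nat.zero_le _)
    | succ k ih =>
      rw [Function.iterate_succ_apply']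
      rcases ih with h | h
      · exact .inl (by rw [h, h])
      · rcases hf _ (hPi k) with h' | h'
        · exact .inl (by rw [h', h'])
        · exact .inr (by omega)
  refine ⟨(key (N + 1)).resolve_right fun h => ?_, hPi _⟩
  have := hN _ (hPi (N + 1))
  omega

/-- Steps that change the state raise `μ` and no step lowers it. So if `μ` does not rise over the
whole pass, every step acted on the original `a` and left it alone. -/
theorem foldl_eq_or_lt {α β : Type*} {f : α → β → α} {P : α → Prop} (μ : α → ℕ)
    (hP : ∀ a b, P a → P (f a b)) (hf : ∀ a b, P a → f a b = a ∨ μ a < μ (f a b)) (l : List β) :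
    ∀ a, P a → P (l.foldl f a) ∧
      ((l.foldl f a = a ∧ ∀ b ∈ l, f a b = a) ∨ μ a < μ (l.foldl f a)) := by
  induction l with
  | nil => intro a ha; simpa using ha
  | cons b l ih =>
    intro a ha
    obtain ⟨h1, h2⟩ := ih (f a b) (hP a b ha)
    refine ⟨h1, ?_⟩
    rw [List.foldl_cons]
    rcases hf a b ha with h | h
    · rw [h] at h2 ⊢
      rcases h2 with ⟨h2, h3⟩ | h2
      · exact .inl ⟨h2, by simpa [h] using h3⟩
      · exact .inr h2
    · rcases h2 with ⟨h2, -⟩ | h2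
      · rw [h2]; exact .inr h
      · exact .inr (h.trans h2)

namespace SimpleGraph

/-! ### Two-colouring -/

section Colouring

variable {n : ℕ} (G : SimpleGraph (Fin n)) (S : Finset (Fin n))

/-- `c` is a proper colouring of `S` with the colours `1` and `2`. -/
def IsTwoColouring (c : Fin n → ℕ) : Prop :=
  ∀ v ∈ S, (c v = 1 ∨ c v = 2) ∧ ∀ w ∈ S, G.Adj v w → c v ≠ c w

open Classical in
/-- Colour all uncoloured vertices of `S` that have a coloured neighbour. -/
noncomputable def spread (c : Fin n → ℕ) (v : Fin n) : ℕ :=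
  if v ∈ S ∧ c v = 0 then
    if ∃ w, w ∈ S ∧ G.Adj v w ∧ c w = 1 then 2
    else if ∃ w, w ∈ S ∧ G.Adj v w ∧ c w = 2 then 1 else 0
  else c v

open Classical in
/-- Give the vertex `r` the colour `1`, if it is in `S` and uncoloured. -/
noncomputable def seed (r : Fin n) (c : Fin n → ℕ) (v : Fin n) : ℕ :=
  if v = r ∧ v ∈ S ∧ c v = 0 then 1 else c v

/-- A colouring of `S` found by greedy propagation. -/
noncomputable def twoColouring : Fin n → ℕ :=
  (List.finRange n).foldl (fun c r => seed S r ((spread G S)^[n + 1] c)) 0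

variable {G S}

/-- The partial colouring `c` extends to a proper colouring of `S` with two colours. -/
def Extends (G : SimpleGraph (Fin n)) (S : Finset (Fin n)) (c : Fin n → ℕ) : Prop :=
  ∃ d, IsTwoColouring G S d ∧ ∀ v ∈ S, c v ≠ 0 → c v = d v

/-- Propagated colours are forced: next to a vertex of one colour, any proper extension uses the
other. -/
theorem Extends.spread {c : Fin n → ℕ} (h : Extends G S c) : Extends G S (spread G S c) := by
  obtain ⟨d, hd, hc⟩ := h
  refine ⟨d, hd, fun v hv => ?_⟩
  unfold SimpleGraph.spread
  split_ifs with h1 h2 h3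
  · obtain ⟨w, hw, hvw, hcw⟩ := h2
    have := hc w hw (by omega)
    have := (hd v hv).2 w hw hvw
    have := (hd v hv).1
    omega
  · obtain ⟨w, hw, hvw, hcw⟩ := h3
    have := hc w hw (by omega)
    have := (hd v hv).2 w hw hvw
    have := (hd v hv).1
    omega
  · simp
  · exact hc v hv

theorem spread_apply_of_ne_zero {c : Fin n → ℕ} {v : Fin n} (h : c v ≠ 0) :
    spread G S c v = c v := by
  simp [spread, h]

theorem spread_eq_or_lt (c : Fin n → ℕ) : spread G S c = c ∨
    (Finset.univ.filter fun v => c v ≠ 0).card <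
      (Finset.univ.filter fun v => spread G S c v ≠ 0).card := by
  by_cases h : spread G S c = c
  · exact .inl h
  · right
    obtain ⟨v, hv⟩ := Function.ne_iff.1 h
    have hcv : c v = 0 := by
      by_contra h'
      exact hv (spread_apply_of_ne_zero h')
    refine Finset.card_lt_card ⟨fun w hw => ?_, fun h' => ?_⟩
    · simp only [Finset.mem_filter, Finset.mem_univ, true_and] at hw ⊢
      rwa [spread_apply_of_ne_zero hw]
    · have := @h' v (by simpa [hcv] using hv)
      simp [hcv] at this

theorem Extends.iterate_spread {c : Fin n → ℕ} (h : Extends G S c) :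
    SimpleGraph.spread G S ((SimpleGraph.spread G S)^[n + 1] c) =
        (SimpleGraph.spread G S)^[n + 1] c ∧
      Extends G S ((SimpleGraph.spread G S)^[n + 1] c) :=
  iterate_isFixedPt (P := Extends G S) (fun c => (Finset.univ.filter fun v => c v ≠ 0).card)
    (fun _ h => h.spread) (fun c _ => spread_eq_or_lt c)
    (fun c _ => (Finset.card_le_univ _).trans (by simp)) h

/-- A new component may start with either colour. If the given extension `d` uses `2` at `r`, its
colours can be swapped on all uncoloured vertices. -/
theorem Extends.seed {c : Fin n → ℕ} (h : Extends G S c) (hc : SimpleGraph.spread G S c = c)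
    (r : Fin n) : Extends G S (seed S r c) := by
  obtain ⟨d, hd, hcd⟩ := h
  by_cases hr : r ∈ S ∧ c r = 0 ∧ d r = 2
  · obtain ⟨hrS, hcr, hdr⟩ := hr
    -- Since propagation has stabilised, no edge inside `S` joins a coloured to an uncoloured
    -- vertex; this keeps the swapped colouring proper.
    have huncol : ∀ v ∈ S, ∀ w ∈ S, G.Adj v w → c v = 0 → c w = 0 := by
      intro v hv w hw hvw hcv
      by_contra hcw
      have h1 := congrFun hc v
      have h2 := hcd w hw hcw
      have h3 := (hd w hw).1
      have h4 : c w = 1 ∨ c w = 2 := by omega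
      unfold SimpleGraph.spread at h1
      rw [if_pos ⟨hv, hcv⟩, hcv] at h1
      split_ifs at h1 with h5 h6
      rcases h4 with h4 | h4
      · exact h5 ⟨w, hw, hvw, h4⟩
      · exact h6 ⟨w, hw, hvw, h4⟩
    refine ⟨fun v => if c v = 0 then 3 - d v else d v, fun v hv => ⟨?_, fun w hw hvw => ?_⟩,
      fun v hv => ?_⟩
    · have := (hd v hv).1
      dsimp only
      split_ifs <;> omega
    · have h1 := (hd v hv).1
      have h2 := (hd w hw).1
      have h3 := (hd v hv).2 w hw hvw
      have h4 := huncol v hv w hw hvw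
      have h5 := huncol w hw v hv hvw.symm
      dsimp only
      split_ifs <;> grind
    · unfold SimpleGraph.seed
      have := hcd v hv
      dsimp only
      split_ifs with h1 h2 h2
      · rw [h1.1, hdr]; simp
      · exact absurd h1.2.2 h2
      · exact fun h3 => absurd h2 h3
      · exact this
  · refine ⟨d, hd, fun v hv => ?_⟩
    unfold SimpleGraph.seed
    split_ifs with h1
    · obtain ⟨rfl, -, h2⟩ := h1
      have := (hd v hv).1
      have : d v ≠ 2 := fun h => hr ⟨hv, h2, h⟩
      intro _
      omega
    · exact hcd v hv

theorem iterate_spread_ne_zero {c : Fin n → ℕ} {v : Fin n} (h : c v ≠ 0) (k : ℕ) :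
    (spread G S)^[k] c v ≠ 0 := by
  induction k with
  | zero => exact h
  | succ k ih => rwa [Function.iterate_succ_apply', spread_apply_of_ne_zero ih]

/-- Colours are never erased and every vertex of `S` is a seed at some time, so the final partial
colouring is total on `S` and agrees there with a proper one. Hence testing the greedy colouring
decides bipartiteness. -/
theorem isTwoColouring_twoColouring (h : ∃ d, IsTwoColouring G S d) :
    IsTwoColouring G S (twoColouring G S) := by
  have key : ∀ (l : List (Fin n)) c, Extends G S c →
      Extends G S (l.foldl (fun c r => seed S r ((spread G S)^[n + 1] c)) c) ∧
      ∀ v ∈ S, (v ∈ l ∨ c v ≠ 0) →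
        l.foldl (fun c r => seed S r ((spread G S)^[n + 1] c)) c v ≠ 0 := by
    intro l
    induction l with
    | nil => intro c hc; simpa using hc
    | cons r l ih =>
      intro c hc
      obtain ⟨h1, h2⟩ := hc.iterate_spread
      obtain ⟨h3, h4⟩ := ih _ (h2.seed h1 r)
      refine ⟨h3, fun v hv hv' => h4 v hv ?_⟩
      by_cases hvl : v ∈ l
      · exact .inl hvl
      right
      unfold seed
      split_ifs with h5
      · exact one_ne_zero
      · rcases hv' with hv' | hv'
        · simp only [List.mem_cons, hvl, or_false] at hv'
          exact fun h6 => h5 ⟨hv', hv, h6⟩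
        · exact iterate_spread_ne_zero hv' _
  obtain ⟨d₀, hd₀⟩ := h
  obtain ⟨⟨d, hd, hcd⟩, h2⟩ := key (List.finRange n) 0 ⟨d₀, hd₀, by simp⟩
  have heq : ∀ v ∈ S, twoColouring G S v = d v := fun v hv =>
    hcd v hv (h2 v hv (.inl (List.mem_finRange v)))
  intro v hv
  rw [heq v hv]
  exact ⟨(hd v hv).1, fun w hw hvw => by rw [heq w hw]; exact (hd v hv).2 w hw hvw⟩

end Colouring

/-! ### Local search -/

section LocalSearch

variable {n : ℕ}

/-- Apply `move` to all sets `T ∪ {t₁, …, tᵢ}` with `i ≤ k`, one after the other. -/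
def sweep (move : Finset (Fin n) → Finset (Fin n) → Finset (Fin n)) :
    ℕ → Finset (Fin n) → Finset (Fin n) → Finset (Fin n)
  | 0, T, s => move T s
  | k + 1, T, s => (List.finRange n).foldl (fun s t => sweep move k (insert t T) s)
      (sweep move k T s)

/-- Local search for a large set, starting from the empty set. -/
def localSearch (move : Finset (Fin n) → Finset (Fin n) → Finset (Fin n)) (k : ℕ) :
    Finset (Fin n) :=
  (sweep move k ∅)^[n + 1] ∅

open Classical in
/-- Replace `s` by `s'` if `s'` is larger and admissible. -/
noncomputable def improve (p : Finset (Fin n) → Prop) (s s' : Finset (Fin n)) : Finset (Fin n) :=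
  if s.card < s'.card ∧ p s' then s' else s

variable {move : Finset (Fin n) → Finset (Fin n) → Finset (Fin n)} {p : Finset (Fin n) → Prop}

/-- A sweep without gain never changed `s`, so all its moves were tried on the same set. For
nonempty `U`, one element is chosen by the outer loop and the others by the recursive call. -/
theorem sweep_eq_or_lt (hp : ∀ T s, p s → p (move T s))
    (hm : ∀ T s, move T s = s ∨ s.card < (move T s).card) (k : ℕ) : ∀ T s, p s →
      p (sweep move k T s) ∧ ((sweep move k T s = s ∧
        ∀ U : Finset (Fin n), U.card ≤ k → move (T ∪ U) s = s) ∨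
          s.card < (sweep move k T s).card) := by
  induction k with
  | zero =>
    intro T s hs
    refine ⟨hp T s hs, (hm T s).imp (fun h => ⟨h, fun U hU => ?_⟩) id⟩
    obtain rfl : U = ∅ := by simpa using hU
    simpa [sweep] using h
  | succ k ih =>
    intro T s hs
    obtain ⟨h1, h2⟩ := ih T s hs
    obtain ⟨h3, h4⟩ := foldl_eq_or_lt (f := fun s t => sweep move k (insert t T) s) (P := p)
      Finset.card (fun s t h => (ih _ s h).1) (fun s t h => (ih _ s h).2.imp_left And.left)
      (List.finRange n) _ h1
    refine ⟨h3, ?_⟩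
    rw [sweep]
    rcases h2 with ⟨h2, h5⟩ | h2
    · rw [h2] at h4 ⊢
      refine h4.imp_left fun h => ⟨h.1, fun U hU => ?_⟩
      rcases U.eq_empty_or_nonempty with rfl | ⟨t, ht⟩
      · exact h5 ∅ (by simp)
      · have h6 := h.2 t (List.mem_finRange t)
        have h7 := (ih (insert t T) s hs).2.resolve_right (by rw [h6]; exact lt_irrefl _)
        have h8 := h7.2 (U.erase t) (by rw [Finset.card_erase_of_mem ht]; omega)
        rwa [Finset.insert_union, ← Finset.union_insert, Finset.insert_erase ht] at h8
    · rcases h4 with ⟨h4, -⟩ | h4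
      · rw [h4]; exact .inr h2
      · exact .inr (h2.trans h4)

theorem localSearch_spec
    {c : Finset (Fin n) → Finset (Fin n) → Finset (Fin n)} (k : ℕ) (h0 : p ∅) :
    p (localSearch (fun T s => improve p s (c T s)) k) ∧
      ∀ T : Finset (Fin n), T.card ≤ k →
        p (c T (localSearch (fun T s => improve p s (c T s)) k)) →
        (c T (localSearch (fun T s => improve p s (c T s)) k)).card ≤
          (localSearch (fun T s => improve p s (c T s)) k).card := by
  have hsw := sweep_eq_or_lt (move := fun T s => improve p s (c T s)) (p := p)
    (fun T s hs => by unfold improve; split_ifs with h; exacts [h.2, hs])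
    (fun T s => by
      unfold improve
      split_ifs with h
      exacts [.inr h.1, .inl rfl]) k
  obtain ⟨h1, h2⟩ := iterate_isFixedPt (f := sweep (fun T s => improve p s (c T s)) k ∅) (P := p)
    Finset.card (N := n) (fun s hs => (hsw ∅ s hs).1) (fun s hs => (hsw ∅ s hs).2.imp_left And.left)
    (fun s _ => (Finset.card_le_univ s).trans (by simp)) h0
  change p (localSearch _ k) at h2
  change sweep _ k ∅ (localSearch _ k) = localSearch _ k at h1
  refine ⟨h2, fun T hT hpT => ?_⟩
  have h3 := ((hsw ∅ _ h2).2.resolve_right (by rw [h1]; exact lt_irrefl _)).2 T hT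
  by_contra! h4
  rw [Finset.empty_union] at h3
  unfold improve at h3
  rw [if_pos ⟨h4, hpT⟩] at h3
  have h5 := congrArg Finset.card h3
  unfold improve at h4
  omega

end LocalSearch

end SimpleGraph

namespace SimpleGraph

/-! ### Maximum independent sets in bipartite graphs -/

section Auction

variable {n : ℕ} (G : SimpleGraph (Fin n)) (X Y : Finset (Fin n))

/-- The free vertex `x` of `X` can bid for `y`, the first of its cheapest neighbours in `Y`. In an
auction state `z`, the price of a vertex `y` of `Y` is `z y`, and a vertex `x` of `X` is free if
`z x = 0` and is matched to `y` if `z x = y + 1`. -/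
def IsBid (z : Fin n → ℕ) (x y : Fin n) : Prop :=
  x ∈ X ∧ z x = 0 ∧ y ∈ Y ∧ G.Adj x y ∧ z y < n ∧
    ∀ y', y' ∈ Y → G.Adj x y' → z y < z y' ∨ (z y = z y' ∧ y ≤ y')

open Classical in
/-- If `x` can bid for `y`, then `y` becomes more expensive, `x` is matched to `y`, and the vertex
that was matched to `y` becomes free. -/
noncomputable def placeBid (z : Fin n → ℕ) (x v : Fin n) : ℕ :=
  if IsBid G X Y z x v then z v + 1
  else if v = x ∧ ∃ y, IsBid G X Y z x y then ∑ y : Fin n, if IsBid G X Y z x y then y.val + 1 else 0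
  else if v ∈ X ∧ ∃ y, IsBid G X Y z x y ∧ z v = y.val + 1 then 0
  else z v

/-- The outcome of the auction. -/
noncomputable def auction : Fin n → ℕ :=
  (fun z => (List.finRange n).foldl (placeBid G X Y) z)^[n * n + 1] 0

/-- The price of `y` is below a positive number that is not a price. -/
def IsCheap (z : Fin n → ℕ) (y : Fin n) : Prop :=
  ∃ i : Fin n, z y ≤ i.val ∧ ∀ y', y' ∈ Y → z y' ≠ i.val + 1

open Classical in
/-- The cheap vertices of `Y` and the vertices of `X` without cheap neighbours. -/
noncomputable def cheapSet (z : Fin n → ℕ) : Finset (Fin n) :=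
  Finset.univ.filter fun v => (v ∈ Y ∧ IsCheap Y z v) ∨
    (v ∈ X ∧ ∀ y, y ∈ Y → G.Adj v y → ¬ IsCheap Y z y)

/-- The invariant of the auction. -/
structure IsAuctionState (z : Fin n → ℕ) : Prop where
  matched : ∀ x ∈ X, z x ≠ 0 → ∃ y ∈ Y, z x = y.val + 1 ∧ G.Adj x y ∧
    ∀ y' ∈ Y, G.Adj x y' → z y ≤ z y' + 1
  inj : ∀ x ∈ X, ∀ x' ∈ X, z x ≠ 0 → z x = z x' → x = x'
  surj : ∀ y ∈ Y, z y ≠ 0 → ∃ x ∈ X, z x = y.val + 1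
  le : ∀ y ∈ Y, z y ≤ n

variable {G X Y} {z : Fin n → ℕ} {x y : Fin n}

/-- Ties in price are broken by the vertex order; therefore the sum in `placeBid` has at most one
nonzero term. -/
theorem IsBid.unique {y' : Fin n} (h : IsBid G X Y z x y) (h' : IsBid G X Y z x y') : y = y' := by
  obtain ⟨-, -, h1, h2, -, h3⟩ := h
  obtain ⟨-, -, h1', h2', -, h3'⟩ := h'
  have := h3 y' h1' h2'
  have := h3' y h1 h2
  omega

open Classical in
theorem IsBid.placeBid_apply (h : IsBid G X Y z x y) (v : Fin n) :
    placeBid G X Y z x v = if v = y then z y + 1 else if v = x then y.val + 1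
      else if v ∈ X ∧ z v = y.val + 1 then 0 else z v := by
  have hbid : ∀ v, IsBid G X Y z x v ↔ v = y := fun v => ⟨fun h' => h'.unique h, fun h' => h' ▸ h⟩
  unfold placeBid
  simp only [hbid, exists_eq, and_true, exists_eq_left, Finset.sum_ite_eq', Finset.mem_univ, if_true]
  split_ifs <;> simp_all

theorem placeBid_of_not (h : ∀ y, ¬ IsBid G X Y z x y) : placeBid G X Y z x = z := by
  funext v
  simp [placeBid, h]

theorem IsBid.placeBid_ne (h : IsBid G X Y z x y) : placeBid G X Y z x ≠ z := by
  intro h'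
  have := congrFun h' y
  simp [placeBid, h] at this

theorem IsBid.placeBid_of_mem (h : IsBid G X Y z x y) (hXY : Disjoint X Y) {v : Fin n}
    (hv : v ∈ Y) : placeBid G X Y z x v = if v = y then z y + 1 else z v := by
  classical
  rw [h.placeBid_apply]
  have h1 : v ∉ X := Finset.disjoint_right.1 hXY hv
  have h2 : v ≠ x := fun h' => h1 (h' ▸ h.1)
  simp [h1, h2]

theorem placeBid_eq_or_lt (hXY : Disjoint X Y) (z : Fin n → ℕ) (x : Fin n) :
    placeBid G X Y z x = z ∨ ∑ v ∈ Y, z v < ∑ v ∈ Y, placeBid G X Y z x v := by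
  by_cases h : ∃ y, IsBid G X Y z x y
  · obtain ⟨y, h⟩ := h
    right
    refine Finset.sum_lt_sum (fun v hv => ?_) ⟨y, h.2.2.1, ?_⟩
    · rw [h.placeBid_of_mem hXY hv]
      split_ifs with h'
      · rw [h']; omega
      · exact le_rfl
    · rw [h.placeBid_of_mem hXY h.2.2.1]
      simp
  · exact .inl (placeBid_of_not (not_exists.1 h))

/-- The winner took a cheapest neighbour, whose raised price exceeds that of any other neighbour by
at most one. The other matched pairs keep the price of their `Y`-vertex while competing prices can
only rise, and a displaced vertex becomes free. -/
theorem isAuctionState_placeBid (hz : IsAuctionState G X Y z) (hXY : Disjoint X Y) (x : Fin n) :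
    IsAuctionState G X Y (placeBid G X Y z x) := by
  classical
  by_cases h : ∃ y, IsBid G X Y z x y
  swap
  · rwa [placeBid_of_not (not_exists.1 h)]
  obtain ⟨y, h⟩ := h
  have hY : ∀ v ∈ Y, placeBid G X Y z x v = if v = y then z y + 1 else z v :=
    fun v hv => h.placeBid_of_mem hXY hv
  have hyX : y ∉ X := Finset.disjoint_right.1 hXY h.2.2.1
  have hX : ∀ v ∈ X, placeBid G X Y z x v =
      if v = x then y.val + 1 else if z v = y.val + 1 then 0 else z v := by
    intro v hv
    have : v ≠ y := fun h' => hyX (h' ▸ hv)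
    rw [h.placeBid_apply]
    simp [this, hv]
  have hmono : ∀ v ∈ Y, z v ≤ placeBid G X Y z x v := by
    intro v hv
    rw [hY v hv]
    split_ifs with h'
    · rw [h']; omega
    · exact le_rfl
  have hbid := h
  obtain ⟨hx, hzx, hy, hxy, hlt, hmin⟩ := h
  refine ⟨fun v hv => ?_, fun v hv v' hv' => ?_, fun w hw => ?_, fun w hw => ?_⟩
  · rw [hX v hv]
    split_ifs with h1 h2
    · subst h1
      refine fun _ => ⟨y, hy, rfl, hxy, fun y' hy' hvy' => ?_⟩
      have h3 := hmono y' hy'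
      have h4 := hmin y' hy' hvy'
      rw [hY y hy, if_pos rfl]
      omega
    · simp
    · intro h3
      obtain ⟨w, hw, hvw, hadj, hle⟩ := hz.matched v hv h3
      refine ⟨w, hw, hvw, hadj, fun y' hy' hvy' => ?_⟩
      rw [hY w hw, if_neg (by rintro rfl; exact h2 hvw)]
      have h4 := hmono y' hy'
      have h5 := hle y' hy' hvy'
      omega
  · have := hz.inj v hv v' hv'
    rw [hX v hv, hX v' hv']
    split_ifs <;> grind
  · rw [hY w hw]
    split_ifs with h1
    · exact fun _ => ⟨x, hx, by rw [hX x hx, if_pos rfl, h1]⟩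
    · intro h2
      obtain ⟨v, hv, hvw⟩ := hz.surj w hw h2
      refine ⟨v, hv, ?_⟩
      rw [hX v hv, if_neg (by rintro rfl; omega), if_neg fun h3 => h1 (Fin.ext (by omega)), hvw]
  · rw [hY w hw]
    have := hz.le w hw
    split_ifs <;> omega

/-- The potential is the sum of the prices, at most `n * n`. A sweep that fixes the state fixes it
at every single bidder, whereas a possible bid would change it. -/
theorem isAuctionState_auction (hXY : Disjoint X Y) : IsAuctionState G X Y (auction G X Y) ∧
    ∀ x y, ¬ IsBid G X Y (auction G X Y) x y := by
  have hfold := foldl_eq_or_lt (f := placeBid G X Y) (P := IsAuctionState G X Y)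
    (fun z => ∑ v ∈ Y, z v) (fun z x hz => isAuctionState_placeBid hz hXY x)
    (fun z x _ => placeBid_eq_or_lt hXY z x) (List.finRange n)
  obtain ⟨h1, h2⟩ := iterate_isFixedPt (N := n * n) (P := IsAuctionState G X Y) (a := 0)
    (f := fun z => (List.finRange n).foldl (placeBid G X Y) z)
    (fun z => ∑ v ∈ Y, z v) (fun z hz => (hfold z hz).1)
    (fun z hz => (hfold z hz).2.imp_left And.left)
    (fun z hz => (Finset.sum_le_card_nsmul Y z n hz.le).trans
      (Nat.mul_le_mul_right n ((Finset.card_le_univ Y).trans (by simp))))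
    ⟨by simp, by simp, by simp, by simp⟩
  refine ⟨h2, fun x y hbid => hbid.placeBid_ne ?_⟩
  refine ((hfold _ h2).2.resolve_right fun h => ?_).2 x (List.mem_finRange x)
  rw [h1] at h
  exact lt_irrefl _ h

theorem exists_isBid (hx : x ∈ X) (hz : z x = 0) (hy : y ∈ Y) (hxy : G.Adj x y) (hlt : z y < n) :
    ∃ y', IsBid G X Y z x y' := by
  classical
  obtain ⟨y', hy', hmin⟩ := Finset.exists_min_image (Y.filter (G.Adj x))
    (fun y' => toLex (z y', y')) ⟨y, by simp [hy, hxy]⟩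
  simp only [Finset.mem_filter, Prod.Lex.toLex_le_toLex] at hy' hmin
  refine ⟨y', hx, hz, hy'.1, hy'.2, ?_, fun y'' h1 h2 => hmin y'' ⟨h1, h2⟩⟩
  have := hmin y ⟨hy, hxy⟩
  omega

/-- If all of `1, …, n` were prices, `Y` would contain every vertex; but a vertex of positive price
has a partner in `X`, which is disjoint from `Y`. -/
theorem IsAuctionState.exists_gap (hz : IsAuctionState G X Y z) (hXY : Disjoint X Y)
    (hn : 0 < n) :
    ∃ i : Fin n, ∀ y ∈ Y, z y ≠ i.val + 1 := by
  by_contra! h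
  choose f hfY hf using h
  have hinj : Function.Injective f := fun i j hij => by
    have h1 := hf i
    have h2 := hf j
    rw [hij] at h1
    exact Fin.ext (by omega)
  obtain ⟨x, hx, -⟩ := hz.surj (f ⟨0, hn⟩) (hfY _) (by rw [hf]; omega)
  obtain ⟨i, rfl⟩ := Finite.surjective_of_injective hinj x
  exact Finset.disjoint_left.1 hXY hx (hfY i)

theorem cheapSet_subset : cheapSet G X Y z ⊆ X ∪ Y := by
  intro v hv
  simp only [cheapSet, Finset.mem_filter, Finset.mem_univ, true_and] at hv
  rw [Finset.mem_union]
  tauto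

theorem isIndepSet_cheapSet (hX : G.IsIndepSet (X : Set (Fin n)))
    (hY : G.IsIndepSet (Y : Set (Fin n))) : G.IsIndepSet (cheapSet G X Y z : Set (Fin n)) := by
  intro u hu v hv huv hadj
  simp only [cheapSet, Finset.coe_filter, Finset.mem_univ, true_and, Set.mem_ofPred_eq] at hu hv
  rcases hu with ⟨hu, hu'⟩ | ⟨hu, hu'⟩ <;> rcases hv with ⟨hv, hv'⟩ | ⟨hv, hv'⟩
  · exact hY hu hv huv hadj
  · exact hv' u hu hadj.symm hu'
  · exact hu' v hv hadj hv'
  · exact hX hu hv huv hadj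

/-- The matching sends `J \ cheapSet` injectively into `cheapSet \ J`: a vertex outside the cheap
set is matched, its partner lies in the cheap set, and the partner is not in `J` because the two are
adjacent. -/
theorem IsAuctionState.card_le (hz : IsAuctionState G X Y z) (hXY : Disjoint X Y)
    (hbid : ∀ x y, ¬ IsBid G X Y z x y) {J : Finset (Fin n)} (hJ : J ⊆ X ∪ Y)
    (hindep : G.IsIndepSet (J : Set (Fin n))) : J.card ≤ (cheapSet G X Y z).card := by
  classical
  have hmem : ∀ v, v ∈ cheapSet G X Y z ↔ (v ∈ Y ∧ IsCheap Y z v) ∨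
      (v ∈ X ∧ ∀ y, y ∈ Y → G.Adj v y → ¬ IsCheap Y z y) := fun v => by simp [cheapSet]
  -- A matched vertex with a cheap neighbour is matched to a cheap vertex.
  have hcheap : ∀ x ∈ X, ∀ y ∈ Y, G.Adj x y → IsCheap Y z y →
      ∃ y' ∈ Y, z x = y'.val + 1 ∧ G.Adj x y' ∧ IsCheap Y z y' := by
    rintro x hx y hy hxy ⟨i, hi, hgap⟩
    -- A free vertex with a cheap neighbour could still bid, since the price of that neighbour is
    -- below `n`.
    have h0 : z x ≠ 0 := fun h0 => by
      obtain ⟨y', h'⟩ := exists_isBid hx h0 hy hxy (hi.trans_lt i.2)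
      exact hbid x y' h'
    obtain ⟨y', hy', hxy', hadj, hle⟩ := hz.matched x hx h0
    refine ⟨y', hy', hxy', hadj, i, ?_, hgap⟩
    -- The partner costs at most `z y + 1 ≤ i + 1`, and the value `i + 1` is excluded by the gap.
    have := hle y hy hxy
    have := hgap y' hy'
    omega
  suffices (J \ cheapSet G X Y z).card ≤ (cheapSet G X Y z \ J).card by
    have h1 := Finset.card_sdiff_add_card_inter J (cheapSet G X Y z)
    have h2 := Finset.card_sdiff_add_card_inter (cheapSet G X Y z) J
    rw [Finset.inter_comm] at h2
    omega
  refine Finset.card_le_card_of_forall_subsingleton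
    (fun a b => (a ∈ X ∧ b ∈ Y ∧ z a = b.val + 1) ∨ (b ∈ X ∧ a ∈ Y ∧ z b = a.val + 1)) ?_ ?_
  · intro a ha
    obtain ⟨haJ, hac⟩ := Finset.mem_sdiff.1 ha
    rw [hmem] at hac
    push Not at hac
    rcases Finset.mem_union.1 (hJ haJ) with haX | haY
    · obtain ⟨y, hy, hay, hyc⟩ := hac.2 haX
      obtain ⟨y', hy', hay', hadj, hyc'⟩ := hcheap a haX y hy hay hyc
      refine ⟨y', Finset.mem_sdiff.2 ⟨(hmem _).2 (.inl ⟨hy', hyc'⟩), fun hyJ => ?_⟩,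
        .inl ⟨haX, hy', hay'⟩⟩
      exact hindep haJ hyJ hadj.ne hadj
    -- Price zero lies below every gap, so an unpriced vertex would be cheap.
    · have h0 : z a ≠ 0 := fun h0 => by
        obtain ⟨i, hi⟩ := hz.exists_gap hXY a.pos
        exact hac.1 haY ⟨i, by omega, hi⟩
      obtain ⟨x, hx, hxa⟩ := hz.surj a haY h0
      obtain ⟨y, hy, hxy, hadj, -⟩ := hz.matched x hx (by omega)
      obtain rfl : y = a := Fin.ext (by omega)
      refine ⟨x, Finset.mem_sdiff.2 ⟨(hmem _).2 (.inr ⟨hx, fun y' hy' hxy' hc => ?_⟩),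
        fun hxJ => hindep hxJ haJ hadj.ne hadj⟩, .inr ⟨hx, haY, hxa⟩⟩
      obtain ⟨y'', hy'', hxy'', -, hc'⟩ := hcheap x hx y' hy' hxy' hc
      obtain rfl : y'' = y := Fin.ext (by omega)
      exact hac.1 haY hc'
  · intro b hb a ha a' ha'
    have hdis : ∀ v, v ∈ X → v ∈ Y → False := fun v h h' => Finset.disjoint_left.1 hXY h h'
    rcases ha.2 with ⟨h1, h2, h3⟩ | ⟨h1, h2, h3⟩ <;>
      rcases ha'.2 with ⟨h1', h2', h3'⟩ | ⟨h1', h2', h3'⟩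
    · exact hz.inj a h1 a' h1' (by omega) (by omega)
    · exact (hdis b h1' h2).elim
    · exact (hdis b h1 h2').elim
    · exact Fin.ext (by omega)

end Auction

end SimpleGraph

/-! ### Approximating the bipartite part and completing small sets -/

namespace SimpleGraph

section Solve

variable {n : ℕ} (G : SimpleGraph (Fin n))

open Classical in
/-- A maximum independent subset of `S`, if `S` induces a bipartite graph. -/
noncomputable def bipartiteIndepSet (S : Finset (Fin n)) : Finset (Fin n) :=
  cheapSet G {v | v ∈ S ∧ twoColouring G S v = 1} {v | v ∈ S ∧ twoColouring G S v = 2}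
    (auction G {v | v ∈ S ∧ twoColouring G S v = 1} {v | v ∈ S ∧ twoColouring G S v = 2})

open Classical in
/-- The vertices of `S` outside `D` that have no neighbour in `D`. -/
noncomputable def remainder (S D : Finset (Fin n)) : Finset (Fin n) :=
  {v | v ∈ S ∧ v ∉ D ∧ ∀ w, w ∈ D → ¬ G.Adj v w}

/-- Exchange up to `k` vertices of `s` as long as this leads to a larger set that induces a
bipartite graph. -/
noncomputable def largeBipartiteSet (k : ℕ) : Finset (Fin n) :=
  localSearch (fun T s => improve (fun s => IsTwoColouring G s (twoColouring G s)) s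
    (symmDiff s T)) k

/-- The largest independent set that consists of at most `k` vertices and a set found by
`bipartiteIndepSet` among the vertices of `S` not adjacent to them. -/
noncomputable def extendedIndepSet (k : ℕ) (S : Finset (Fin n)) : Finset (Fin n) :=
  localSearch (fun D s => improve (fun s => ∀ v, v ∈ s → ∀ w, w ∈ s → ¬ G.Adj v w) s
    (D ∪ bipartiteIndepSet G (remainder G S D))) k

variable {G}

theorem bipartiteIndepSet_spec {S : Finset (Fin n)} (hS : ∃ d, IsTwoColouring G S d) :
    bipartiteIndepSet G S ⊆ S ∧ G.IsIndepSet (bipartiteIndepSet G S : Set (Fin n)) ∧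
      ∀ J ⊆ S, G.IsIndepSet (J : Set (Fin n)) → J.card ≤ (bipartiteIndepSet G S).card := by
  classical
  have hc := isTwoColouring_twoColouring hS
  set c := twoColouring G S with hcdef
  set X : Finset (Fin n) := {v | v ∈ S ∧ c v = 1} with hX
  set Y : Finset (Fin n) := {v | v ∈ S ∧ c v = 2} with hY
  have hXY : Disjoint X Y := Finset.disjoint_left.2 fun v hv hv' => by
    simp only [hX, hY, Finset.mem_filter] at hv hv'
    omega
  have hU : X ∪ Y = S := by
    ext v
    have := hc v
    simp only [hX, hY, Finset.mem_union, Finset.mem_filter, Finset.mem_univ, true_and]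
    tauto
  have hXi : G.IsIndepSet (X : Set (Fin n)) := fun u hu v hv _ huv => by
    simp only [hX, Finset.coe_filter, Finset.mem_univ, true_and, Set.mem_ofPred_eq] at hu hv
    exact (hc u hu.1).2 v hv.1 huv (hu.2.trans hv.2.symm)
  have hYi : G.IsIndepSet (Y : Set (Fin n)) := fun u hu v hv _ huv => by
    simp only [hY, Finset.coe_filter, Finset.mem_univ, true_and, Set.mem_ofPred_eq] at hu hv
    exact (hc u hu.1).2 v hv.1 huv (hu.2.trans hv.2.symm)
  have heq : bipartiteIndepSet G S = cheapSet G X Y (auction G X Y) := by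
    unfold bipartiteIndepSet
    congr
  obtain ⟨h1, h2⟩ := isAuctionState_auction (G := G) hXY
  rw [heq]
  refine ⟨hU ▸ cheapSet_subset, isIndepSet_cheapSet hXi hYi, fun J hJ hJi => ?_⟩
  exact h1.card_le hXY h2 (hU ▸ hJ) hJi

/-- Two vertices of `T` in the same clique are adjacent and so get different values of `κ`; the pair
of value and clique determines the vertex. -/
theorem card_le_of_cliques {α : Type*} [Fintype α] {l : ℕ} {k : ℕ}
    {part : Fin n → Fin k ⊕ Fin l} (hpart : ∀ j : Fin l, G.IsClique {v | part v = Sum.inr j})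
    {T : Finset (Fin n)} (κ : Fin n → α) (hκ : ∀ u ∈ T, ∀ v ∈ T, G.Adj u v → κ u ≠ κ v)
    (hT : ∀ v ∈ T, (part v).isRight) : T.card ≤ Fintype.card α * l := by
  classical
  have hinj : Set.InjOn (fun v => (κ v, part v)) (T : Set (Fin n)) := by
    intro u hu v hv huv
    obtain ⟨j, hj⟩ := Sum.isRight_iff.1 (hT u hu)
    simp only [Prod.mk.injEq] at huv
    by_contra hne
    exact hκ u hu v hv (hpart j (show part u = _ from hj) (show part v = _ from huv.2 ▸ hj) hne)
      huv.1
  refine (Finset.card_le_card_of_injOn (t := Finset.univ ×ˢ Finset.univ.map .inr) _ ?_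
    hinj).trans ?_
  · intro v hv
    obtain ⟨j, hj⟩ := Sum.isRight_iff.1 (hT v hv)
    simp [hj]
  · simp

theorem IsTwoColouring.mono {S S' : Finset (Fin n)} {d : Fin n → ℕ} (h : IsTwoColouring G S d)
    (hS : S' ⊆ S) : IsTwoColouring G S' d := fun v hv =>
  ⟨(h v (hS hv)).1, fun w hw => (h v (hS hv)).2 w (hS hw)⟩

/-- A local optimum for exchanges of size `2 * k + 1` is at least as large as a set that contains
all but `k` of its vertices. -/
theorem card_le_largeBipartiteSet {k : ℕ} {B : Finset (Fin n)} (hB : ∃ d, IsTwoColouring G B d)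
    (h : (largeBipartiteSet G (2 * k + 1) \ B).card ≤ k) :
    B.card ≤ (largeBipartiteSet G (2 * k + 1)).card := by
  classical
  have hopt := (localSearch_spec (p := fun s => IsTwoColouring G s (twoColouring G s))
    (c := fun T s => symmDiff s T) (2 * k + 1) (by simp [IsTwoColouring])).2
  change ∀ T, _ → IsTwoColouring G (symmDiff (largeBipartiteSet G (2 * k + 1)) T)
      (twoColouring G (symmDiff (largeBipartiteSet G (2 * k + 1)) T)) →
    (symmDiff (largeBipartiteSet G (2 * k + 1)) T).card ≤
      (largeBipartiteSet G (2 * k + 1)).card at hopt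
  set S := largeBipartiteSet G (2 * k + 1)
  by_contra! hlt
  have h1 := Finset.card_sdiff_add_card_inter B S
  have h2 := Finset.card_sdiff_add_card_inter S B
  rw [Finset.inter_comm] at h2
  -- Dropping at most `k` vertices and adding one more than were dropped is an exchange of at most
  -- `2 * k + 1` vertices.
  obtain ⟨A, hA, hAc⟩ := Finset.exists_subset_card_eq (s := B \ S) (n := (S \ B).card + 1)
    (by omega)
  have heq : symmDiff S ((S \ B) ∪ A) = (B ∩ S) ∪ A := by
    ext v
    have := @hA v
    simp only [Finset.mem_symmDiff, Finset.mem_union, Finset.mem_sdiff, Finset.mem_inter] at *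
    tauto
  have hsub : (B ∩ S) ∪ A ⊆ B :=
    Finset.union_subset Finset.inter_subset_left (hA.trans Finset.sdiff_subset)
  have h3 := hopt ((S \ B) ∪ A) ((Finset.card_union_le _ _).trans (by omega)) (by
    rw [heq]
    exact isTwoColouring_twoColouring (hB.imp fun d hd => hd.mono hsub))
  rw [heq, Finset.card_union_of_disjoint] at h3
  · omega
  · refine Finset.disjoint_left.2 fun v hv hv' => ?_
    exact (Finset.mem_sdiff.1 (hA hv')).2 (Finset.mem_inter.1 hv).2

/-- For a competitor `I`, the choice `D = I \ S` is among those tried. As `I` is independent, `I ∩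
S` lies in the remainder, so the optimum found there is at least as large. The candidate does not
depend on the current set, so the local search is a plain maximisation over `D`. -/
theorem isMaximumIndepSet_extendedIndepSet {S : Finset (Fin n)} {k : ℕ}
    (hS : ∃ d, IsTwoColouring G S d)
    (hk : ∀ I : Finset (Fin n), G.IsIndepSet (I : Set (Fin n)) → (I \ S).card ≤ k) :
    G.IsMaximumIndepSet (extendedIndepSet G k S) := by
  classical
  have hind : ∀ s : Finset (Fin n), (∀ v, v ∈ s → ∀ w, w ∈ s → ¬ G.Adj v w) ↔
      G.IsIndepSet (s : Set (Fin n)) := fun s =>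
    ⟨fun h v hv w hw _ => h v hv w hw, fun h v hv w hw hvw => h hv hw hvw.ne hvw⟩
  obtain ⟨h1, h2⟩ := localSearch_spec
    (p := fun s : Finset (Fin n) => ∀ v, v ∈ s → ∀ w, w ∈ s → ¬ G.Adj v w)
    (c := fun D _ => D ∪ bipartiteIndepSet G (remainder G S D)) k (by simp)
  change ∀ v, v ∈ extendedIndepSet G k S → _ at h1
  refine ⟨(hind _).1 h1, fun I hI => ?_⟩
  have hrem : ∀ v, v ∈ remainder G S (I \ S) ↔
      v ∈ S ∧ v ∉ I \ S ∧ ∀ w, w ∈ I \ S → ¬ G.Adj v w := fun v => by simp [remainder]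
  obtain ⟨h3, h4, h5⟩ := bipartiteIndepSet_spec (G := G) (S := remainder G S (I \ S))
    (hS.imp fun d hd => hd.mono fun v hv => ((hrem v).1 hv).1)
  have h6 := h2 (I \ S) (hk I hI) ?_
  · refine le_trans ?_ h6
    rw [Finset.card_union_of_disjoint]
    · rw [← Finset.card_sdiff_add_card_inter I S]
      refine Nat.add_le_add_left (h5 _ (fun v hv => (hrem v).2 ?_) ?_) _
      · obtain ⟨hvI, hvS⟩ := Finset.mem_inter.1 hv
        exact ⟨hvS, fun h => (Finset.mem_sdiff.1 h).2 hvS,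
          fun w hw => (hind I).2 hI v hvI w (Finset.mem_sdiff.1 hw).1⟩
      · exact hI.mono (by simp)
    · exact Finset.disjoint_left.2 fun v hv hv' => ((hrem v).1 (h3 hv')).2.1 hv
  · intro v hv w hw hvw
    rcases Finset.mem_union.1 hv with hv | hv <;> rcases Finset.mem_union.1 hw with hw | hw
    · exact (hind I).2 hI v (Finset.mem_sdiff.1 hv).1 w (Finset.mem_sdiff.1 hw).1 hvw
    · exact ((hrem w).1 (h3 hw)).2.2 v hv hvw.symm
    · exact ((hrem v).1 (h3 hv)).2.2 w hw hvw
    · exact (hind _).2 h4 v hv w hw hvw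

theorem IsKLGraph.isMaximumIndepSet {l : ℕ} (hG : IsKLGraph 2 l G) :
    G.IsMaximumIndepSet
      (extendedIndepSet G (3 * l) (largeBipartiteSet G (2 * (2 * l) + 1))) := by
  classical
  obtain ⟨part, hindep, hclique⟩ := hG
  set B : Finset (Fin n) := {v | (part v).isLeft} with hBdef
  have hmem : ∀ v, v ∈ B ↔ (part v).isLeft := fun v => by simp [hBdef]
  have hB : IsTwoColouring G B fun v => if part v = Sum.inl 0 then 1 else 2 := by
    refine fun v hv => ⟨by dsimp only; split_ifs <;> simp, fun w hw hvw h => ?_⟩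
    obtain ⟨i, hi⟩ := Sum.isLeft_iff.1 ((hmem v).1 hv)
    obtain ⟨j, hj⟩ := Sum.isLeft_iff.1 ((hmem w).1 hw)
    have hij : i = j := by
      simp only [hi, hj, Sum.inl.injEq] at h
      split_ifs at h <;> omega
    subst hij
    exact hindep i (show part v = _ from hi) (show part w = _ from hj) hvw.ne hvw
  have hright : ∀ {T : Finset (Fin n)}, ∀ v ∈ T \ B, (part v).isRight := fun v hv => by
    have := (Finset.mem_sdiff.1 hv).2
    rw [hmem] at this
    simpa using this
  have hS : IsTwoColouring G (largeBipartiteSet G (2 * (2 * l) + 1))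
      (twoColouring G (largeBipartiteSet G (2 * (2 * l) + 1))) :=
    (localSearch_spec (p := fun s => IsTwoColouring G s (twoColouring G s))
      (c := fun T s => symmDiff s T) _ (by simp [IsTwoColouring])).1
  set S := largeBipartiteSet G (2 * (2 * l) + 1) with hSdef
  set d := twoColouring G S
  -- A clique has at most one vertex in each of the two colour classes of `S`.
  have hSB : (S \ B).card ≤ 2 * l := by
    refine (card_le_of_cliques hclique (fun v => decide (d v = 1)) (fun u hu v hv huv h => ?_)
      hright).trans (by simp)
    have h1 := (hS u (Finset.mem_sdiff.1 hu).1).1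
    have h2 := (hS v (Finset.mem_sdiff.1 hv).1).1
    have h3 := (hS u (Finset.mem_sdiff.1 hu).1).2 v (Finset.mem_sdiff.1 hv).1 huv
    have h4 : d u = 1 ↔ d v = 1 := by simpa using h
    omega
  have hBS := card_le_largeBipartiteSet ⟨_, hB⟩ hSB
  rw [← hSdef] at hBS
  refine isMaximumIndepSet_extendedIndepSet ⟨_, hS⟩ fun I hI => ?_
  have hIB : (I \ B).card ≤ 1 * l := by
    refine card_le_of_cliques (α := Unit) hclique (fun _ => ()) (fun u hu v hv huv => ?_) hright
    exact (hI (Finset.mem_sdiff.1 hu).1 (Finset.mem_sdiff.1 hv).1 huv.ne huv).elim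
  have h1 := Finset.card_sdiff_add_card_inter B S
  have h2 := Finset.card_sdiff_add_card_inter S B
  rw [Finset.inter_comm] at h2
  -- The two parts have at most `l` and `2 * l` vertices, the latter because `B` is no larger than
  -- `S`.
  have h3 : I \ S ⊆ (I \ B) ∪ (B \ S) := fun v hv => by
    simp only [Finset.mem_union, Finset.mem_sdiff] at *
    tauto
  have h4 := (Finset.card_le_card h3).trans (Finset.card_union_le _ _)
  omega

end Solve

end SimpleGraph

/-! ### Polynomial-time computability of the algorithm -/

namespace RAM

namespace Context

open SimpleGraph

variable {C : Context}

theorem ArrComp.iterate {σ : C.World → Type} {enc : ∀ w, σ w → Fin (C.size w) → ℕ}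
    {N : C.World → ℕ} (hN : C.NatComp N) (B : Polynomial ℕ) (hB : ∀ w, N w ≤ B.eval (C.size w))
    {init : ∀ w, σ w} (hinit : C.ArrComp fun w => enc w (init w)) {f : ∀ w, σ w → σ w}
    (hf : ∀ j hj, (C.addState σ enc N j hj).ArrComp fun w => enc w.1 (f w.1 w.2.1)) :
    C.ArrComp fun w => enc w ((f w)^[N w] (init w)) := by
  have := ArrComp.foldl hN B hB hinit (body := fun w s _ => f w s) hf
  simpa only [List.foldl_const, List.length_finRange] using this

theorem FinsetComp.empty : C.FinsetComp fun _ => ∅ :=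
  .of_mem fun _ _ => ⟨_, .const 0, fun w => by simp⟩

theorem FinsetComp.filter {p : ∀ w, Fin (C.size w) → Prop} {inst : ∀ w, DecidablePred (p w)}
    (hp : ∀ j hj, (C.addVertex j hj).PropComp fun w => p w.1 w.2) :
    C.FinsetComp fun w => {v | p w v} :=
  .of_mem fun j hj => (hp j hj).congr fun _ => Finset.mem_filter_univ _

theorem FinsetComp.insert {t : ∀ w, Fin (C.size w)} {T : ∀ w, Finset (Fin (C.size w))}
    (ht : C.NatComp fun w => (t w).val) (hT : C.FinsetComp T) :
    C.FinsetComp fun w => insert (t w) (T w) :=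
  .of_mem fun _ _ => .congr (.or (.eq_vertex .vertex ht.weaken) (.mem hT.weaken .vertex))
    fun _ => Finset.mem_insert

theorem FinsetComp.union {S T : ∀ w, Finset (Fin (C.size w))} (hS : C.FinsetComp S)
    (hT : C.FinsetComp T) : C.FinsetComp fun w => S w ∪ T w :=
  .of_mem fun _ _ => .congr (.or (.mem hS.weaken .vertex) (.mem hT.weaken .vertex))
    fun _ => Finset.mem_union

theorem FinsetComp.symmDiff {S T : ∀ w, Finset (Fin (C.size w))} (hS : C.FinsetComp S)
    (hT : C.FinsetComp T) : C.FinsetComp fun w => symmDiff (S w) (T w) :=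
  .of_mem fun _ _ => .congr (.or (.and (.mem hS.weaken .vertex) (.not (.mem hT.weaken .vertex)))
    (.and (.mem hT.weaken .vertex) (.not (.mem hS.weaken .vertex)))) fun _ => Finset.mem_symmDiff

theorem ArrComp.spread {S : ∀ w, Finset (Fin (C.size w))} {c : ∀ w, Fin (C.size w) → ℕ}
    (hS : C.FinsetComp S) (hc : C.ArrComp c) :
    C.ArrComp fun w => spread (C.graph w) (S w) (c w) := by
  refine .tabulate fun j hj => .ite (.and (.mem hS.weaken .vertex)
    (.eq (.get hc.weaken .vertex) (.const 0))) (.ite ?_ (.const 2) (.ite ?_ (.const 1) (.const 0)))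
    (.get hc.weaken .vertex)
  · exact .exists fun i hi => .and (.mem hS.weaken.weaken .vertex) (.and
      (.adj (NatComp.weaken .vertex) .vertex) (.eq (.get hc.weaken.weaken .vertex) (.const 1)))
  · exact .exists fun i hi => .and (.mem hS.weaken.weaken .vertex) (.and
      (.adj (NatComp.weaken .vertex) .vertex) (.eq (.get hc.weaken.weaken .vertex) (.const 2)))

theorem ArrComp.seed {S : ∀ w, Finset (Fin (C.size w))} {c : ∀ w, Fin (C.size w) → ℕ}
    {r : ∀ w, Fin (C.size w)} (hS : C.FinsetComp S) (hr : C.NatComp fun w => (r w).val)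
    (hc : C.ArrComp c) : C.ArrComp fun w => seed (S w) (r w) (c w) :=
  .tabulate fun _ _ => .ite (.and (.eq_vertex .vertex hr.weaken)
    (.and (.mem hS.weaken .vertex) (.eq (.get hc.weaken .vertex) (.const 0))))
    (.const 1) (.get hc.weaken .vertex)

theorem NatComp.size_add_one : C.NatComp fun w => C.size w + 1 := NatComp.size.add (.const 1)

theorem ArrComp.twoColouring {S : ∀ w, Finset (Fin (C.size w))} (hS : C.FinsetComp S) :
    C.ArrComp fun w => twoColouring (C.graph w) (S w) := by
  refine ArrComp.foldl (σ := fun w => Fin (C.size w) → ℕ) (enc := fun _ z => z) (N := C.size)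
    .size .X (fun w => by simp) (init := fun _ => 0) (.tabulate fun _ _ => .const 0) fun j hj => ?_
  refine ArrComp.seed hS.weaken .index ?_
  refine ArrComp.iterate (C := C.addState (fun w => Fin (C.size w) → ℕ) (fun _ z => z) C.size j hj)
    (σ := fun w => Fin (C.size w.1) → ℕ) (enc := fun _ z => z) (N := fun w => C.size w.1 + 1)
    .size_add_one (.X + 1) (fun w => by simp) (init := fun w => w.2.1) .state
    (f := fun w => SimpleGraph.spread (C.graph w.1) (S w.1)) fun i hi => ?_
  exact ArrComp.spread hS.weaken.weaken .state

theorem PropComp.isTwoColouring {S : ∀ w, Finset (Fin (C.size w))} {c : ∀ w, Fin (C.size w) → ℕ}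
    (hS : C.FinsetComp S) (hc : C.ArrComp c) :
    C.PropComp fun w => IsTwoColouring (C.graph w) (S w) (c w) := by
  refine .forall fun j hj => .imp (.mem hS.weaken .vertex) (.and
    (.or (.eq (.get hc.weaken .vertex) (.const 1)) (.eq (.get hc.weaken .vertex) (.const 2)))
    (.forall fun i hi => .imp (.mem hS.weaken.weaken .vertex)
      (.imp (.adj (NatComp.weaken .vertex) .vertex) (.not (.eq
        (.get hc.weaken.weaken (NatComp.weaken .vertex)) (.get hc.weaken.weaken .vertex))))))

theorem PropComp.isBid {X Y : ∀ w, Finset (Fin (C.size w))} {z : ∀ w, Fin (C.size w) → ℕ}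
    {x y : ∀ w, Fin (C.size w)} (hX : C.FinsetComp X) (hY : C.FinsetComp Y) (hz : C.ArrComp z)
    (hx : C.NatComp fun w => (x w).val) (hy : C.NatComp fun w => (y w).val) :
    C.PropComp fun w => IsBid (C.graph w) (X w) (Y w) (z w) (x w) (y w) := by
  refine .and (.mem hX hx) (.and (.eq (.get hz hx) (.const 0)) (.and (.mem hY hy)
    (.and (.adj hx hy) (.and (.lt (.get hz hy) .size) (.forall fun j hj => ?_)))))
  refine .imp (.mem hY.weaken .vertex) (.imp (.adj hx.weaken .vertex) (.or
    (.lt (.get hz.weaken hy.weaken) (.get hz.weaken .vertex))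
    (.and (.eq (.get hz.weaken hy.weaken) (.get hz.weaken .vertex)) ?_)))
  exact PropComp.le hy.weaken .vertex

theorem ArrComp.placeBid {X Y : ∀ w, Finset (Fin (C.size w))} {z : ∀ w, Fin (C.size w) → ℕ}
    {x : ∀ w, Fin (C.size w)} (hX : C.FinsetComp X) (hY : C.FinsetComp Y) (hz : C.ArrComp z)
    (hx : C.NatComp fun w => (x w).val) :
    C.ArrComp fun w => placeBid (C.graph w) (X w) (Y w) (z w) (x w) := by
  refine .tabulate fun j hj => .ite (.isBid hX.weaken hY.weaken hz.weaken hx.weaken .vertex)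
    (.add (.get hz.weaken .vertex) (.const 1)) (.ite (.and (.eq_vertex .vertex hx.weaken)
      (.exists fun i hi => .isBid hX.weaken.weaken hY.weaken.weaken hz.weaken.weaken
        hx.weaken.weaken .vertex)) (.sum fun i hi => .ite (.isBid hX.weaken.weaken hY.weaken.weaken
        hz.weaken.weaken hx.weaken.weaken .vertex) (.add .vertex (.const 1)) (.const 0))
      (.ite (.and (.mem hX.weaken .vertex) (.exists fun i hi => .and (.isBid hX.weaken.weaken
        hY.weaken.weaken hz.weaken.weaken hx.weaken.weaken .vertex)
        (.eq (.get hz.weaken.weaken (NatComp.weaken .vertex)) (.add .vertex (.const 1)))))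
        (.const 0) (.get hz.weaken .vertex)))

theorem ArrComp.auction {X Y : ∀ w, Finset (Fin (C.size w))} (hX : C.FinsetComp X)
    (hY : C.FinsetComp Y) : C.ArrComp fun w => auction (C.graph w) (X w) (Y w) := by
  have hN : C.NatComp fun w => C.size w * C.size w + 1 :=
    (NatComp.add (NatComp.sum (f := fun w _ => C.size w) fun _ _ => .size) (.const 1)).congr
      fun w => by simp
  refine ArrComp.iterate (σ := fun w => Fin (C.size w) → ℕ) (enc := fun _ z => z)
    hN (.X * .X + 1) (fun w => by simp) (init := fun _ => 0) (.tabulate fun _ _ => .const 0)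
    (f := fun w z => (List.finRange (C.size w)).foldl
      (SimpleGraph.placeBid (C.graph w) (X w) (Y w)) z) fun j hj => ?_
  refine ArrComp.foldl (C := C.addState (fun w => Fin (C.size w) → ℕ) (fun _ z => z)
      (fun w => C.size w * C.size w + 1) j hj)
    (σ := fun w => Fin (C.size w.1) → ℕ) (enc := fun _ z => z) (N := fun w => C.size w.1)
    .size .X (fun w => by simp) (init := fun w => w.2.1) .state
    (body := fun w => SimpleGraph.placeBid (C.graph w.1) (X w.1) (Y w.1)) fun i hi => ?_
  exact ArrComp.placeBid hX.weaken.weaken hY.weaken.weaken .state .index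

theorem PropComp.isCheap {Y : ∀ w, Finset (Fin (C.size w))} {z : ∀ w, Fin (C.size w) → ℕ}
    {y : ∀ w, Fin (C.size w)} (hY : C.FinsetComp Y) (hz : C.ArrComp z)
    (hy : C.NatComp fun w => (y w).val) : C.PropComp fun w => IsCheap (Y w) (z w) (y w) :=
  .exists fun _ _ => .and (.le (.get hz.weaken hy.weaken) .vertex) (.forall fun _ _ =>
    .imp (.mem hY.weaken.weaken .vertex) (.not (.eq (.get hz.weaken.weaken .vertex)
      (.add (NatComp.weaken .vertex) (.const 1)))))

theorem FinsetComp.cheapSet {X Y : ∀ w, Finset (Fin (C.size w))} {z : ∀ w, Fin (C.size w) → ℕ}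
    (hX : C.FinsetComp X) (hY : C.FinsetComp Y) (hz : C.ArrComp z) :
    C.FinsetComp fun w => cheapSet (C.graph w) (X w) (Y w) (z w) := by
  unfold SimpleGraph.cheapSet
  exact .filter fun j hj => .or (.and (.mem hY.weaken .vertex)
    (.isCheap hY.weaken hz.weaken .vertex)) (.and (.mem hX.weaken .vertex) (.forall fun i hi =>
      .imp (.mem hY.weaken.weaken .vertex) (.imp (.adj (NatComp.weaken .vertex) .vertex)
        (.not (.isCheap hY.weaken.weaken hz.weaken.weaken .vertex)))))

theorem FinsetComp.bipartiteIndepSet {S : ∀ w, Finset (Fin (C.size w))} (hS : C.FinsetComp S) :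
    C.FinsetComp fun w => bipartiteIndepSet (C.graph w) (S w) := by
  classical
  have h : ∀ a : ℕ, C.FinsetComp fun w =>
      {v | v ∈ S w ∧ SimpleGraph.twoColouring (C.graph w) (S w) v = a} := fun a =>
    .filter fun j hj => .and (.mem hS.weaken .vertex)
      (.eq (.get (ArrComp.weaken (.twoColouring hS)) .vertex) (.const a))
  convert FinsetComp.cheapSet (h 1) (h 2) (.auction (h 1) (h 2)) using 2 with w
  unfold SimpleGraph.bipartiteIndepSet
  congr

theorem FinsetComp.remainder {S D : ∀ w, Finset (Fin (C.size w))} (hS : C.FinsetComp S)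
    (hD : C.FinsetComp D) : C.FinsetComp fun w => remainder (C.graph w) (S w) (D w) := by
  unfold SimpleGraph.remainder
  exact .filter fun j hj => .and (.mem hS.weaken .vertex) (.and (.not (.mem hD.weaken .vertex))
    (.forall fun i hi => .imp (.mem hD.weaken.weaken .vertex)
      (.not (.adj (NatComp.weaken .vertex) .vertex))))

theorem FinsetComp.improve {p : ∀ w, Finset (Fin (C.size w)) → Prop}
    {s s' : ∀ w, Finset (Fin (C.size w))} (hp : C.PropComp fun w => p w (s' w))
    (hs : C.FinsetComp s) (hs' : C.FinsetComp s') :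
    C.FinsetComp fun w => improve (p w) (s w) (s' w) := by
  have h := (PropComp.lt hs.card hs'.card).and hp
  refine .of_mem fun j hj => PropComp.congr (.or (.and h.weaken (.mem hs'.weaken .vertex))
    (.and (.not h.weaken) (.mem hs.weaken .vertex))) fun w => ?_
  unfold SimpleGraph.improve
  split_ifs with h' <;> tauto

/-- An operation on two sets of vertices of a graph, with a further set as parameter, that is
computable in polynomial time. -/
def MoveComp (move : ∀ {n : ℕ}, SimpleGraph (Fin n) → Finset (Fin n) → Finset (Fin n) →
    Finset (Fin n) → Finset (Fin n)) : Prop :=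
  ∀ (C : Context) (Q T s : ∀ w, Finset (Fin (C.size w))), C.FinsetComp Q → C.FinsetComp T →
    C.FinsetComp s → C.FinsetComp fun w => move (C.graph w) (Q w) (T w) (s w)

section LocalSearch

variable {move : ∀ {n : ℕ}, SimpleGraph (Fin n) → Finset (Fin n) → Finset (Fin n) →
  Finset (Fin n) → Finset (Fin n)}

/-- This unfolds to `k` nested loops. The inner sweep runs in a context enlarged by the current set
and the loop vertex, so the induction needs a hypothesis quantified over all contexts. -/
theorem MoveComp.sweep (h : MoveComp move) (k : ℕ) :
    MoveComp fun G Q T s => sweep (move G Q) k T s := by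
  induction k with
  | zero => exact h
  | succ k ih =>
    intro C Q T s hQ hT hs
    refine ArrComp.foldl (σ := fun w => Finset (Fin (C.size w))) (enc := fun _ => indicator)
      (N := C.size) .size .X (fun w => by simp) (ih C Q T s hQ hT hs)
      (body := fun w s t => SimpleGraph.sweep (move (C.graph w) (Q w)) k (Insert.insert t (T w)) s)
      fun j hj => ?_
    exact ih (C.addState (fun w => Finset (Fin (C.size w))) (fun _ => indicator) C.size j hj)
      (fun w => Q w.1) (fun w => Insert.insert w.2.2 (T w.1)) (fun w => w.2.1) hQ.weaken
      (.insert .index hT.weaken) .state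

theorem MoveComp.localSearch (h : MoveComp move) (k : ℕ) {Q : ∀ w, Finset (Fin (C.size w))}
    (hQ : C.FinsetComp Q) : C.FinsetComp fun w => localSearch (move (C.graph w) (Q w)) k := by
  refine ArrComp.iterate (σ := fun w => Finset (Fin (C.size w))) (enc := fun _ => indicator)
    .size_add_one (.X + 1) (fun w => by simp) (init := fun _ => ∅) FinsetComp.empty
    (f := fun w => SimpleGraph.sweep (move (C.graph w) (Q w)) k ∅) fun j hj => ?_
  exact h.sweep k (C.addState (fun w => Finset (Fin (C.size w))) (fun _ => indicator)
    (fun w => C.size w + 1) j hj) (fun w => Q w.1) (fun _ => ∅) (fun w => w.2.1) hQ.weaken .empty .state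

end LocalSearch

theorem FinsetComp.largeBipartiteSet (k : ℕ) :
    C.FinsetComp fun w => largeBipartiteSet (C.graph w) k :=
  MoveComp.localSearch (move := fun G _ T s => SimpleGraph.improve
    (fun s => IsTwoColouring G s (SimpleGraph.twoColouring G s)) s (_root_.symmDiff s T))
    (fun _ _ _ _ _ hT hs => .improve (.isTwoColouring (hs.symmDiff hT) (.twoColouring
      (hs.symmDiff hT))) hs (hs.symmDiff hT)) k .empty

theorem FinsetComp.extendedIndepSet (k : ℕ) {S : ∀ w, Finset (Fin (C.size w))}
    (hS : C.FinsetComp S) : C.FinsetComp fun w => extendedIndepSet (C.graph w) k (S w) := by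
  refine MoveComp.localSearch (move := fun G S D s => SimpleGraph.improve
    (fun s => ∀ v, v ∈ s → ∀ w, w ∈ s → ¬ G.Adj v w) s
      (D ∪ SimpleGraph.bipartiteIndepSet G (SimpleGraph.remainder G S D)))
    (fun C S D s hS hD hs => ?_) k hS
  have h := hD.union (.bipartiteIndepSet (.remainder hS hD))
  exact .improve (.forall fun j hj => .imp (.mem h.weaken .vertex) (.forall fun i hi =>
    .imp (.mem h.weaken.weaken .vertex) (.not (.adj (NatComp.weaken .vertex) .vertex)))) hs h

/-! ### The input graph and the final program -/

/-- The initial situation: only the input graph is in the memory. -/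
def initial : Context where
  World := Σ n, SimpleGraph (Fin n)
  size w := w.1
  graph w := w.2
  bound := 1
  Holds w m := m.reg 0 = w.1 ∧ ∀ u v : Fin w.1, m.arr 0 (u.val * w.1 + v.val) ≠ 0 ↔ w.2.Adj u v
  bound_pos := one_pos
  congr h h' := by rwa [h.reg one_pos, h.arr one_pos]
  reg_zero h := h.1
  arr_zero h := h.2

theorem initial_holds_input {n : ℕ} (G : SimpleGraph (Fin n)) :
    initial.Holds ⟨n, G⟩ (input G) := by
  refine ⟨by simp [input], fun u v => ?_⟩
  have h : (∃ u' v' : Fin n, u.val * n + v.val = u'.val * n + v'.val ∧ G.Adj u' v') ↔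
      G.Adj u v := by
    refine ⟨?_, fun h => ⟨u, v, rfl, h⟩⟩
    rintro ⟨u', v', h, hadj⟩
    -- Row-major addresses are injective on pairs of vertices, so a cell represents only one pair.
    have h' : finProdFinEquiv (u, v) = finProdFinEquiv (u', v') := by
      apply Fin.ext
      simp only [finProdFinEquiv_apply_val]
      linarith
    obtain ⟨rfl, rfl⟩ := Prod.ext_iff.1 (finProdFinEquiv.injective h')
    exact hadj
  simp [input, h]

theorem FinsetComp.exists_program {S : ∀ {n : ℕ}, SimpleGraph (Fin n) → Finset (Fin n)}
    (hS : initial.FinsetComp fun w => S w.2) : ∃ (p : Program) (T : Polynomial ℕ),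
      ∀ (n : ℕ) (G : SimpleGraph (Fin n)), ∃ t m, Runs p (input G) t m ∧ t ≤ T.eval n ∧
        output n m = S G := by
  obtain ⟨p, T, h⟩ := hS 1 le_rfl
  refine ⟨p, T, fun n G => ?_⟩
  obtain ⟨t, m, hr, ht, -, hm⟩ := h ⟨n, G⟩ (input G) (initial_holds_input G)
  refine ⟨t, m, hr, ht, ?_⟩
  ext v
  have := hm v
  simp only [output, Finset.mem_filter, Finset.mem_univ, true_and, this]
  simp only [indicator, ne_eq, ite_eq_right_iff, one_ne_zero, imp_false, not_not]
  exact Iff.rfl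

end Context

end RAM

/-- The time bound holds on every graph; membership in the class is used only for the correctness of
the output. -/
theorem mainTheorem4 (l : ℕ) :
    MaxIndepSetInPolyTime (fun G => IsKLGraph 2 l G) := by
  obtain ⟨p, T, h⟩ := RAM.Context.FinsetComp.exists_program
    (S := fun G => G.extendedIndepSet (3 * l) (G.largeBipartiteSet (2 * (2 * l) + 1)))
    (.extendedIndepSet _ (.largeBipartiteSet _))
  refine ⟨p, T, fun n G hG => ?_⟩
  obtain ⟨t, m, hr, ht, hm⟩ := h n G
  exact ⟨t, m, hr, ht, hm ▸ SimpleGraph.IsKLGraph.isMaximumIndepSet hG⟩
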